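/- Let $d\ge 2$ be an integer, let $\mathbf I$ be the identity and $\mathbf V$ the flip operator, $\mathbf V(\varphi\otimes\psi)=\psi\otimes\varphi$, on $\mathbb C^d\otimes\mathbb C^d$, and for $\eta\in\mathbb R$ let $$W_d^\eta=\Big(\frac{d-1+\eta}{d-1}\Big)\frac{\mathbf I}{d^2}-\Big(\frac{\eta}{d-1}\Big)\frac{\mathbf V}{d}$$ be the Werner operator. Assume that $W_d^\eta$ is a state, i.e. positive semidefinite of trace one (equivalently, $-\frac{d-1}{d+1}\le\eta\le 1$). An observable of Alice is a Hermitian operator $A$ on $\mathbb C^d$ (possibly with degenerate eigenvalues), with set of eigenvalues $\lambda(A)$; for $a\in\lambda(A)$ let $\Pi_a^A$ be the orthogonal projection onto the eigenspace of $A$ for $a$. If Alice, sharing a state $W$ with Bob, measures $A$ on the first factor and obtains the result $a$, then Bob's unnormalized conditioned state is $\tilde\rho_a^A=\mathrm{Tr}_1[W(\Pi_a^A\otimes\mathbf I)]$. A set $\mathfrak M$ of observables of Alice exhibits steering on $W$ if there do not exist a probability space $(\Xi,\mu)$, a measurable family $(\rho_\xi)_{\xi\in\Xi}$ of states of Bob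 and, for each $A\in\mathfrak M$, measurable functions $\xi\mapsto\wp(a|A,\xi)\ge0$, $a\in\lambda(A)$, with $\sum_{a\in\lambda(A)}\wp(a|A,\xi)=1$ for all $\xi$, such that $$\tilde\rho_a^A=\int_\Xi \wp(a|A,\xi)\,\rho_\xi\,d\mu(\xi)\qquad\text{for all }A\in\mathfrak M,\ a\in\lambda(A).$$ The state $W$ is steerable (by Alice) if some set $\mathfrak M$ of observables exhibits steering on $W$. Then the set of all observables (all projective measurements) of Alice exhibits steering on $W_d^\eta$ if and only if $\eta>1-\frac1d$; and $W_d^\eta$ is steerable if and only if $\eta>1-\frac1d$. -/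

import Mathlib

open MeasureTheory
open scoped Kronecker ComplexOrder

universe u

noncomputable section

namespace QSteering

/-- A (normalized) quantum state on `ℂⁿ`: a positive semidefinite matrix of trace one. -/
def IsState {n : Type*} [Fintype n] (ρ : Matrix n n ℂ) : Prop :=
  ρ.PosSemidef ∧ ρ.trace = 1

/-- An observable on `ℂⁿ`, that is, a Hermitian matrix. Its eigenvalues may be degenerate. -/
abbrev Observable (n : Type*) : Type _ := {A : Matrix n n ℂ // A.IsHermitian}

/-- The possible results of measuring `A`: the (finite) set of eigenvalues of `A`. -/
def Observable.outcomes {n : Type*} [Fintype n] [DecidableEq n] (A : Observable n) : Finset ℝ :=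
  (Matrix.finite_real_spectrum (A := A.1)).toFinset

/-- The projector belonging to the result `a` of `A`: the matrix of the orthogonal projection
onto the eigenspace of `A` for the eigenvalue `a`. -/
def Observable.projector {n : Type*} [Fintype n] [DecidableEq n]
    (A : Observable n) (a : ℝ) : Matrix n n ℂ :=
  (Matrix.toEuclideanCLM (n := n) (𝕜 := ℂ)).symm
    (Module.End.eigenspace (Matrix.toEuclideanLin A.1) (a : ℂ)).starProjection

/-- The partial trace over the first (Alice's) tensor factor. -/
def partialTraceA {m n : Type*} [Fintype m] (X : Matrix (m × n) (m × n) ℂ) : Matrix n n ℂ :=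
  Matrix.of fun i j => ∑ k, X (k, i) (k, j)

/-- Bob's unnormalized state conditioned on Alice measuring `A` on her part of `W` and obtaining
the result `a`. -/
def condState {m n : Type*} [Fintype m] [DecidableEq m] [Fintype n] [DecidableEq n]
    (W : Matrix (m × n) (m × n) ℂ) (A : Observable m) (a : ℝ) : Matrix n n ℂ :=
  partialTraceA (W * (A.projector a ⊗ₖ (1 : Matrix n n ℂ)))

/-- The results of the measurements in `M`, performed by Alice on her part of `W`, can be explained
by a local hidden state model for Bob: there are an ensemble of states `ρ ξ`, with `ξ` distributed
according to a probability measure `μ`, and for each `A ∈ M` a stochastic map `p A` from `ξ` to the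
results of `A`, such that for every `A ∈ M` and every result `a` the conditioned state of Bob is the
average of `p A a ξ • ρ ξ` over `ξ` (written entry by entry). The ensemble is the same for all
measurements in `M`. -/
def HasLHSModel {m n : Type*} [Fintype m] [DecidableEq m] [Fintype n] [DecidableEq n]
    (M : Set (Observable m)) (W : Matrix (m × n) (m × n) ℂ) : Prop :=
  ∃ (Ξ : Type u) (_ : MeasurableSpace Ξ) (μ : Measure Ξ)
    (ρ : Ξ → Matrix n n ℂ) (p : Observable m → ℝ → Ξ → ℝ),
    IsProbabilityMeasure μ ∧
    (∀ ξ, IsState (ρ ξ)) ∧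
    (∀ i j, Measurable fun ξ => ρ ξ i j) ∧
    (∀ A ∈ M, ∀ a ∈ A.outcomes, Measurable (p A a)) ∧
    (∀ A ∈ M, ∀ a ∈ A.outcomes, ∀ ξ, 0 ≤ p A a ξ) ∧
    (∀ A ∈ M, ∀ ξ, ∑ a ∈ A.outcomes, p A a ξ = 1) ∧
    (∀ A ∈ M, ∀ a ∈ A.outcomes, ∀ i j,
      condState W A a i j = ∫ ξ, (p A a ξ : ℂ) * ρ ξ i j ∂μ)

/-- Alice's measurement strategy `M` on `W` exhibits steering. -/
def ExhibitsSteering {m n : Type*} [Fintype m] [DecidableEq m] [Fintype n] [DecidableEq n]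
    (M : Set (Observable m)) (W : Matrix (m × n) (m × n) ℂ) : Prop :=
  ¬ HasLHSModel.{u} M W

/-- `W` is steerable (by Alice): some measurement strategy, i.e. some set of observables of Alice,
exhibits steering. -/
def Steerable {m n : Type*} [Fintype m] [DecidableEq m] [Fintype n] [DecidableEq n]
    (W : Matrix (m × n) (m × n) ℂ) : Prop :=
  ∃ M : Set (Observable m), ExhibitsSteering.{u} M W

/-- The flip operator `V (φ ⊗ ψ) = ψ ⊗ φ` on `ℂᵈ ⊗ ℂᵈ`. -/
def flipOperator (d : ℕ) : Matrix (Fin d × Fin d) (Fin d × Fin d) ℂ :=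
  Matrix.of fun x y => if x = y.swap then 1 else 0

theorem flipOperator_mulVec (d : ℕ) (φ ψ : Fin d → ℂ) :
    (flipOperator d).mulVec (fun x => φ x.1 * ψ x.2) = fun x => ψ x.1 * φ x.2 := by
  funext x
  have h (y : Fin d × Fin d) : (x = y.swap) ↔ (x.swap = y) := by
    constructor <;> rintro rfl <;> simp
  simp [flipOperator, Matrix.mulVec, dotProduct, h, mul_comm]

/-- The `d × d` Werner state with mixing parameter `η`:
`((d - 1 + η) / (d - 1)) I / d² - (η / (d - 1)) V / d`. -/
def wernerState (d : ℕ) (η : ℝ) : Matrix (Fin d × Fin d) (Fin d × Fin d) ℂ :=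
  ((((d : ℝ) - 1 + η) / ((d : ℝ) - 1) / (d : ℝ) ^ 2 : ℝ) : ℂ) •
      (1 : Matrix (Fin d × Fin d) (Fin d × Fin d) ℂ) -
    ((η / ((d : ℝ) - 1) / (d : ℝ) : ℝ) : ℂ) • flipOperator d

end QSteering

end

noncomputable section

namespace QSteering

open Real Set Filter Topology

/-! Everything rests on the least component of a random vector. If `x` is Gaussian on `ℂᵈ`, the `‖x
i‖ ^ 2` are independent exponential variables of mean one, so the expected minimum is `1 / d` and
the expected maximum is the harmonic number `H`; the law is unitarily invariant, so this holds in
every orthonormal basis.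

Model for `η ≤ 1 - 1 / d`: the hidden state is the pure state along `x`, with `x` weighted by its
squared norm. Alice expands `x` in an eigenbasis of her observable and selects an index by a
permutation-equivariant rule depending only on the squared moduli. By symmetry, the resulting moment
matrix is a combination of the identity and the projector on the selected basis vector, just as
Bob's conditioned Werner state is. Only one number remains to be matched: the expected squared
modulus of the selected component must be `1 - η`. Mixing "least" with "greatest" reaches every
value in `[1 / d, H]`. The threshold is the lower end; positivity of the Werner operator gives `1 -
η ≤ 2 d / (d + 1) ≤ H` (`exists_response`, `IsResponse.integral_mul_mul_conj_unitary`,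
`hasLHSModel_wernerState`).

Converse: for a nondegenerate observable with eigenbasis `U`, a model makes the mean over `ξ` of a
convex combination of the diagonal entries of `ρ ξ` in the basis `U` equal to `(1 - η) / d`, so the
mean of the least entry is at most that. Averaged over Haar-distributed `U`, however, the least
diagonal entry of any state is at least `1 / d ^ 2`: the minimum is superadditive, which reduces the
claim to pure states, and there the value comes from the Gaussian computation. Comparing the two
bounds gives `1 / d ≤ 1 - η` (`lintegral_minEntry_diagIn_le`,
`IsState.le_lintegral_minEntry_diagIn`, `le_of_hasLHSModel`). -/

/-- The standard Gaussian probability measure on `ℂ`, normalized so that `‖z‖ ^ 2` has mean one. -/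
def complexGaussian : Measure ℂ :=
  volume.withDensity fun z => ENNReal.ofReal (π⁻¹ * exp (-‖z‖ ^ 2))

/-! ### Radial integrals and tails of the Gaussian on `ℂ`. -/

theorem integral_Ioi_mul_exp_neg_sq {a : ℝ} :
    IntegrableOn (fun r : ℝ => r * exp (-r ^ 2)) (Ioi |a|) ∧
    ∫ r in Ioi |a|, r * exp (-r ^ 2) = exp (-a ^ 2) / 2 := by
  have hd : ∀ r ∈ Ici |a|, HasDerivAt (fun r : ℝ => -exp (-r ^ 2) / 2) (r * exp (-r ^ 2)) r := by
    intro r _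
    have h1 : HasDerivAt (fun r : ℝ => -r ^ 2) (-(2 * r)) r := by
      convert! (hasDerivAt_pow 2 r).neg using 1
      simp
    convert! (h1.exp.neg.div_const 2) using 1
    ring
  have hpos : ∀ r ∈ Ioi |a|, 0 ≤ r * exp (-r ^ 2) := fun r hr =>
    mul_nonneg ((abs_nonneg a).trans (le_of_lt hr)) (exp_pos _).le
  have hlim : Tendsto (fun r : ℝ => -exp (-r ^ 2) / 2) atTop (𝓝 0) := by
    have : Tendsto (fun r : ℝ => exp (-r ^ 2)) atTop (𝓝 0) :=
      tendsto_exp_atBot.comp (tendsto_neg_atTop_atBot.comp (tendsto_pow_atTop two_ne_zero))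
    simpa using this.neg.div_const 2
  refine ⟨integrableOn_Ioi_deriv_of_nonneg' hd hpos hlim, ?_⟩
  rw [integral_Ioi_of_hasDerivAt_of_nonneg' hd hpos hlim, sq_abs]
  ring

theorem integrable_exp_neg_norm_sq : Integrable fun z : ℂ => exp (-‖z‖ ^ 2) := by
  have h := (integrable_fun_norm_addHaar (volume : Measure ℂ) (f := fun r => exp (-r ^ 2)))
  rw [h]
  simpa using (integral_Ioi_mul_exp_neg_sq (a := 0)).1

theorem integral_indicator_exp_neg_norm_sq {t : ℝ} (ht : 0 ≤ t) :
    ∫ z in {z : ℂ | t ≤ ‖z‖ ^ 2}, π⁻¹ * exp (-‖z‖ ^ 2) = exp (-t) := by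
  have hm : MeasurableSet {z : ℂ | t ≤ ‖z‖ ^ 2} :=
    measurableSet_le measurable_const (by fun_prop)
  rw [← integral_indicator hm]
  have h := integral_fun_norm_addHaar (volume : Measure ℂ)
    ((Ici (√t)).indicator fun r => π⁻¹ * exp (-r ^ 2))
  have e1 : ({z : ℂ | t ≤ ‖z‖ ^ 2}.indicator fun z : ℂ => π⁻¹ * exp (-‖z‖ ^ 2)) =
      fun z : ℂ => (Ici (√t)).indicator (fun r => π⁻¹ * exp (-r ^ 2)) ‖z‖ := by
    funext z
    by_cases hz : t ≤ ‖z‖ ^ 2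
    · have : √t ≤ ‖z‖ := by rw [Real.sqrt_le_left (norm_nonneg z)]; exact hz
      simp [indicator, hz, this]
    · have : ¬ √t ≤ ‖z‖ := by rw [Real.sqrt_le_left (norm_nonneg z)]; exact hz
      simp [indicator, hz, this]
  have e2 : ∫ r in Ioi (0 : ℝ), r ^ (Module.finrank ℝ ℂ - 1) •
      (Ici (√t)).indicator (fun r => π⁻¹ * exp (-r ^ 2)) r = π⁻¹ * (exp (-t) / 2) := by
    have : (fun r : ℝ => r ^ (Module.finrank ℝ ℂ - 1) •
        (Ici (√t)).indicator (fun r => π⁻¹ * exp (-r ^ 2)) r) =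
        (Ici (√t)).indicator fun r => π⁻¹ * (r * exp (-r ^ 2)) := by
      funext r
      simp only [indicator, Complex.finrank_real_complex]
      split_ifs
      · simp; ring
      · simp
    rw [this, setIntegral_indicator measurableSet_Ici]
    have h3 : (∫ r in Ioi (0 : ℝ) ∩ Ici √t, π⁻¹ * (r * exp (-r ^ 2))) =
        ∫ r in Ioi |√t|, π⁻¹ * (r * exp (-r ^ 2)) := by
      rw [abs_of_nonneg (sqrt_nonneg t)]
      refine setIntegral_congr_set ?_
      have h4 : (Ioi (0 : ℝ) ∩ Ici √t : Set ℝ) =ᵐ[volume] (Ioi (0 : ℝ) ∩ Ioi √t : Set ℝ) :=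
        (ae_eq_refl _).inter Ioi_ae_eq_Ici.symm
      refine h4.trans ?_
      rw [inter_eq_right.2 (Ioi_subset_Ioi (sqrt_nonneg t))]
      exact ae_eq_refl _
    rw [h3, integral_const_mul, integral_Ioi_mul_exp_neg_sq.2, sq_sqrt ht]
  rw [e1, h, e2]
  have : (volume : Measure ℂ).real (Metric.ball 0 1) = π := by
    simp [Measure.real, Complex.volume_ball]
  rw [this, Complex.finrank_real_complex]
  simp only [nsmul_eq_mul, smul_eq_mul]
  field_simp
  norm_num

theorem complexGaussian_apply {s : Set ℂ} (hs : MeasurableSet s) :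
    complexGaussian s = ENNReal.ofReal (∫ z in s, π⁻¹ * exp (-‖z‖ ^ 2)) := by
  rw [complexGaussian, withDensity_apply _ hs, ofReal_integral_eq_lintegral_ofReal]
  · exact (integrable_exp_neg_norm_sq.const_mul _).integrableOn
  · exact ae_of_all _ fun z => by positivity

/-- In polar coordinates the radial density is `2 r exp (-r ^ 2)`, so the squared modulus is an
exponential variable of mean one. The distribution of extreme components below uses only this. -/
theorem complexGaussian_le_norm_sq {t : ℝ} (ht : 0 ≤ t) :
    complexGaussian {z | t ≤ ‖z‖ ^ 2} = ENNReal.ofReal (exp (-t)) := by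
  rw [complexGaussian_apply (measurableSet_le measurable_const (by fun_prop)),
    integral_indicator_exp_neg_norm_sq ht]

instance : IsProbabilityMeasure complexGaussian := by
  constructor
  have := complexGaussian_le_norm_sq le_rfl
  have e : {z : ℂ | 0 ≤ ‖z‖ ^ 2} = univ := by
    ext z; simp
  rw [e] at this
  simpa using this

theorem complexGaussian_real_norm_sq_lt {t : ℝ} (ht : 0 ≤ t) :
    complexGaussian.real {z | ‖z‖ ^ 2 < t} = 1 - exp (-t) := by
  have hm : MeasurableSet {z : ℂ | t ≤ ‖z‖ ^ 2} :=
    measurableSet_le measurable_const (by fun_prop)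
  have e : {z : ℂ | ‖z‖ ^ 2 < t} = {z | t ≤ ‖z‖ ^ 2}ᶜ := by
    ext z; simp
  rw [e, probReal_compl_eq_one_sub hm, measureReal_def, complexGaussian_le_norm_sq ht,
    ENNReal.toReal_ofReal (exp_pos _).le]

theorem integrable_norm_sq_complexGaussian :
    Integrable (fun z : ℂ => ‖z‖ ^ 2) complexGaussian := by
  refine ⟨by fun_prop, ?_⟩
  rw [hasFiniteIntegral_iff_ofReal (ae_of_all _ fun z => by positivity),
    lintegral_eq_lintegral_meas_le _ (ae_of_all _ fun z => by positivity) (by fun_prop)]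
  rw [setLIntegral_congr_fun measurableSet_Ioi
    (fun t ht => complexGaussian_le_norm_sq (le_of_lt ht))]
  rw [← ofReal_integral_eq_lintegral_ofReal]
  · simp
  · exact integrableOn_exp_neg_Ioi 0
  · exact ae_of_all _ fun z => by positivity

/-! ### The Gaussian on `ℂᵈ` and its unitary invariance. -/

/-- The standard Gaussian probability measure on `ℂᵈ`. -/
def gaussianVec (d : ℕ) : Measure (Fin d → ℂ) := Measure.pi fun _ => complexGaussian

instance (d : ℕ) : IsProbabilityMeasure (gaussianVec d) := by
  unfold gaussianVec; infer_instance

theorem gaussianVec_eq_withDensity (d : ℕ) :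
    gaussianVec d = volume.withDensity
      fun x => ENNReal.ofReal (∏ i, (π⁻¹ * exp (-‖x i‖ ^ 2))) := by
  refine (Measure.pi_eq fun s hs => ?_)
  rw [withDensity_apply _ (MeasurableSet.univ_pi hs), volume_pi, Measure.restrict_pi_pi]
  rw [← ofReal_integral_eq_lintegral_ofReal]
  · rw [integral_fintype_prod_eq_prod (𝕜 := ℝ) (fun i z => π⁻¹ * exp (-‖z‖ ^ 2)),
      ENNReal.ofReal_prod_of_nonneg]
    · exact Finset.prod_congr rfl fun i _ => (complexGaussian_apply (hs i)).symm
    · exact fun i _ => integral_nonneg fun z => by positivity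
  · exact Integrable.fintype_prod_dep (𝕜 := ℝ) (f := fun i z => π⁻¹ * exp (-‖z‖ ^ 2))
      fun i => (integrable_exp_neg_norm_sq.const_mul _).integrableOn
  · exact ae_of_all _ fun z => by positivity

theorem gaussianVec_eq_withDensity_sum (d : ℕ) :
    gaussianVec d = volume.withDensity
      fun x => ENNReal.ofReal (π⁻¹ ^ d * exp (-∑ i, ‖x i‖ ^ 2)) := by
  rw [gaussianVec_eq_withDensity]
  congr 1
  funext x
  rw [Finset.prod_mul_distrib, ← exp_sum, Finset.sum_neg_distrib]
  simp

theorem sum_norm_sq_mulVec {d : ℕ} {U : Matrix (Fin d) (Fin d) ℂ}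
    (hU : U ∈ Matrix.unitaryGroup (Fin d) ℂ) (x : Fin d → ℂ) :
    ∑ i, ‖U.mulVec x i‖ ^ 2 = ∑ i, ‖x i‖ ^ 2 := by
  have key : ∀ y : Fin d → ℂ, ((∑ i, ‖y i‖ ^ 2 : ℝ) : ℂ) = star y ⬝ᵥ y := by
    intro y
    simp only [dotProduct, Pi.star_apply, RCLike.star_def, Complex.conj_mul']
    push_cast; rfl
  have : star (U.mulVec x) ⬝ᵥ U.mulVec x = star x ⬝ᵥ x := by
    rw [Matrix.star_mulVec, Matrix.dotProduct_mulVec, Matrix.vecMul_vecMul,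
      ← Matrix.star_eq_conjTranspose, Matrix.mem_unitaryGroup_iff'.1 hU, Matrix.vecMul_one]
  exact_mod_cast (key _).trans (this.trans (key x).symm)

/-- The density depends only on the norm, and Lebesgue measure is scaled by a constant under an
invertible linear map. Hence the image is a multiple of the original measure, and equality of total
masses forces the factor to be one, with no determinant to compute. -/
theorem measurePreserving_mulVec {d : ℕ} {U : Matrix (Fin d) (Fin d) ℂ}
    (hU : U ∈ Matrix.unitaryGroup (Fin d) ℂ) :
    MeasurePreserving U.mulVec (gaussianVec d) (gaussianVec d) := by
  have hmeas : Measurable U.mulVec :=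
    (Continuous.matrix_mulVec continuous_const continuous_id).measurable
  refine ⟨hmeas, ?_⟩
  let L : (Fin d → ℂ) →ₗ[ℝ] (Fin d → ℂ) := U.mulVecLin.restrictScalars ℝ
  have hL : LinearMap.det L ≠ 0 := by
    have hinv : ((star U).mulVecLin.restrictScalars ℝ) ∘ₗ L = LinearMap.id := by
      refine LinearMap.ext fun y => ?_
      simp only [L, LinearMap.comp_apply, LinearMap.restrictScalars_apply,
        Matrix.mulVecLin_apply, Matrix.mulVec_mulVec, Matrix.mem_unitaryGroup_iff'.1 hU]
      simp
    intro h0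
    have := congrArg LinearMap.det hinv
    rw [LinearMap.det_comp, h0] at this
    simp at this
  have hmap := Measure.map_linearMap_addHaar_eq_smul_addHaar
    (volume : Measure (Fin d → ℂ)) hL
  have hscale : ∃ c : ENNReal, (gaussianVec d).map U.mulVec = c • gaussianVec d := by
    refine ⟨ENNReal.ofReal |(LinearMap.det L)⁻¹|, Measure.ext fun s hs => ?_⟩
    rw [Measure.map_apply hmeas hs, Measure.smul_apply, gaussianVec_eq_withDensity_sum,
      withDensity_apply _ (hmeas hs), withDensity_apply _ hs]
    have hg : Measurable fun x : Fin d → ℂ =>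
        ENNReal.ofReal (π⁻¹ ^ d * exp (-∑ i, ‖x i‖ ^ 2)) := by fun_prop
    have h1 := setLIntegral_map (μ := (volume : Measure (Fin d → ℂ))) hs hg hmeas
    simp only [sum_norm_sq_mulVec hU] at h1
    rw [← h1]
    change ∫⁻ y in s, _ ∂(Measure.map L volume) = _
    rw [hmap, Measure.restrict_smul, lintegral_smul_measure]
  obtain ⟨c, hc⟩ := hscale
  have h1 := congrArg (fun ν => ν univ) hc
  simp only [Measure.map_apply hmeas MeasurableSet.univ, preimage_univ, measure_univ,
    Measure.smul_apply, smul_eq_mul, mul_one] at h1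
  rw [hc, ← h1, one_smul]

theorem integrable_norm_sq_apply {d : ℕ} (i : Fin d) :
    Integrable (fun x : Fin d → ℂ => ‖x i‖ ^ 2) (gaussianVec d) :=
  integrable_comp_eval (μ := fun _ : Fin d => complexGaussian) (i := i)
    integrable_norm_sq_complexGaussian

theorem integral_norm_sq_apply {d : ℕ} (i : Fin d) :
    ∫ x, ‖x i‖ ^ 2 ∂(gaussianVec d) = 1 := by
  have h := integral_comp_eval (μ := fun _ : Fin d => complexGaussian) (i := i)
    (f := fun z : ℂ => ‖z‖ ^ 2) integrable_norm_sq_complexGaussian.aestronglyMeasurable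
  refine h.trans ?_
  rw [Integrable.integral_eq_integral_meas_le integrable_norm_sq_complexGaussian
    (ae_of_all _ fun z => by positivity)]
  rw [setIntegral_congr_fun measurableSet_Ioi (g := fun t => exp (-t))]
  · exact integral_exp_neg_Ioi_zero
  · intro t ht
    simp only [measureReal_def]
    rw [complexGaussian_le_norm_sq (le_of_lt ht), ENNReal.toReal_ofReal (exp_pos _).le]

/-- By independence the tails multiply: the minimum of `d` unit exponentials is exponential of rate
`d`. -/
theorem gaussianVec_forall_le {d : ℕ} {t : ℝ} (ht : 0 ≤ t) :
    (gaussianVec d).real {x | ∀ i, t ≤ ‖x i‖ ^ 2} = exp (-(d * t)) := by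
  have e : {x : Fin d → ℂ | ∀ i, t ≤ ‖x i‖ ^ 2} = univ.pi fun _ => {z | t ≤ ‖z‖ ^ 2} := by
    ext x; simp
  rw [e, measureReal_def, gaussianVec, Measure.pi_pi]
  simp only [complexGaussian_le_norm_sq ht, Finset.prod_const, Finset.card_univ, Fintype.card_fin,
    ENNReal.toReal_pow, ENNReal.toReal_ofReal (exp_pos _).le]
  rw [← exp_nat_mul, mul_neg]

theorem gaussianVec_exists_le {d : ℕ} {t : ℝ} (ht : 0 ≤ t) :
    (gaussianVec d).real {x | ∃ i, t ≤ ‖x i‖ ^ 2} = 1 - (1 - exp (-t)) ^ d := by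
  have hm : MeasurableSet {z : ℂ | ‖z‖ ^ 2 < t} :=
    measurableSet_lt (by fun_prop) measurable_const
  have e : {x : Fin d → ℂ | ∃ i, t ≤ ‖x i‖ ^ 2} = (univ.pi fun _ => {z | ‖z‖ ^ 2 < t})ᶜ := by
    ext x; simp
  rw [e, probReal_compl_eq_one_sub (MeasurableSet.univ_pi fun _ => hm), measureReal_def,
    gaussianVec, Measure.pi_pi]
  simp only [Finset.prod_const, Finset.card_univ, Fintype.card_fin,
    ENNReal.toReal_pow]
  rw [← measureReal_def, complexGaussian_real_norm_sq_lt ht]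

/-! ### Extreme components and response rules. -/

/-- The vector of squared moduli of the components of a vector in `ℂᵈ`. -/
def sqModuli {d : ℕ} (x : Fin d → ℂ) : Fin d → ℝ := fun i => ‖x i‖ ^ 2

@[fun_prop]
theorem measurable_sqModuli {d : ℕ} : Measurable (sqModuli (d := d)) := by
  unfold sqModuli; fun_prop

/-- The least component of a vector. -/
def minEntry {d : ℕ} [NeZero d] (X : Fin d → ℝ) : ℝ := Finset.univ.inf' Finset.univ_nonempty X

/-- The greatest component of a vector. -/
def maxEntry {d : ℕ} [NeZero d] (X : Fin d → ℝ) : ℝ := Finset.univ.sup' Finset.univ_nonempty X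

section responses

variable {d : ℕ} [NeZero d]

theorem minEntry_le (X : Fin d → ℝ) (i : Fin d) : minEntry X ≤ X i :=
  Finset.inf'_le _ (Finset.mem_univ i)

theorem le_minEntry_iff {X : Fin d → ℝ} {t : ℝ} : t ≤ minEntry X ↔ ∀ i, t ≤ X i := by
  simp [minEntry]

theorem le_maxEntry_iff {X : Fin d → ℝ} {t : ℝ} : t ≤ maxEntry X ↔ ∃ i, t ≤ X i := by
  simp [maxEntry]

theorem minEntry_neg (X : Fin d → ℝ) : minEntry (-X) = -maxEntry X := by
  refine le_antisymm ?_ ?_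
  · rw [le_neg]
    exact Finset.sup'_le _ _ fun i _ => le_neg.1 (minEntry_le (-X) i)
  · rw [le_minEntry_iff]
    intro i
    simp only [Pi.neg_apply, neg_le_neg_iff]
    exact le_maxEntry_iff.2 ⟨i, le_rfl⟩

@[fun_prop]
theorem measurable_minEntry : Measurable (minEntry (d := d)) := by
  refine measurable_of_Ici fun t => ?_
  have : minEntry (d := d) ⁻¹' Ici t = ⋂ i, {X | t ≤ X i} := by
    ext X; simp [le_minEntry_iff]
  rw [this]
  exact MeasurableSet.iInter fun i => measurableSet_le measurable_const (measurable_pi_apply i)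

@[fun_prop]
theorem measurable_maxEntry : Measurable (maxEntry (d := d)) := by
  have : maxEntry (d := d) = fun X => -minEntry (-X) := by
    funext X; simp [minEntry_neg]
  rw [this]
  fun_prop

theorem minEntry_nonneg {X : Fin d → ℝ} (hX : 0 ≤ X) : 0 ≤ minEntry X :=
  le_minEntry_iff.2 hX

theorem maxEntry_nonneg {X : Fin d → ℝ} (hX : 0 ≤ X) : 0 ≤ maxEntry X :=
  le_maxEntry_iff.2 ⟨0, hX 0⟩

theorem sqModuli_nonneg {d : ℕ} (x : Fin d → ℂ) : 0 ≤ sqModuli x := fun _ => by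
  simp [sqModuli]

theorem integrable_sum_sqModuli {d : ℕ} :
    Integrable (fun x : Fin d → ℂ => ∑ i, sqModuli x i) (gaussianVec d) :=
  integrable_finsetSum _ fun i _ => integrable_norm_sq_apply i

theorem integrable_minEntry :
    Integrable (fun x : Fin d → ℂ => minEntry (sqModuli x)) (gaussianVec d) := by
  have hm := (measurable_minEntry.comp (measurable_sqModuli (d := d))).aestronglyMeasurable
    (μ := gaussianVec d)
  refine (integrable_norm_sq_apply (0 : Fin d)).mono' hm (ae_of_all _ fun x => ?_)
  rw [norm_eq_abs, abs_of_nonneg (minEntry_nonneg (sqModuli_nonneg x))]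
  exact minEntry_le (sqModuli x) 0

theorem integrable_maxEntry :
    Integrable (fun x : Fin d → ℂ => maxEntry (sqModuli x)) (gaussianVec d) := by
  have hm := (measurable_maxEntry.comp (measurable_sqModuli (d := d))).aestronglyMeasurable
    (μ := gaussianVec d)
  refine (integrable_sum_sqModuli (d := d)).mono' hm (ae_of_all _ fun x => ?_)
  rw [norm_eq_abs, abs_of_nonneg (maxEntry_nonneg (sqModuli_nonneg x))]
  exact Finset.sup'_le _ _ fun i hi =>
    Finset.single_le_sum (fun j _ => sqModuli_nonneg x j) hi

theorem integral_minEntry :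
    ∫ x, minEntry (sqModuli x) ∂(gaussianVec d) = 1 / d := by
  rw [integrable_minEntry.integral_eq_integral_meas_le
    (ae_of_all _ fun x => minEntry_nonneg (sqModuli_nonneg x))]
  have hd : (0 : ℝ) < d := Nat.cast_pos.2 (NeZero.pos d)
  rw [setIntegral_congr_fun measurableSet_Ioi (g := fun t => exp (-d * t))]
  · rw [integral_exp_mul_Ioi (by simpa using hd)]
    simp
  · intro t ht
    simp only [le_minEntry_iff, sqModuli]
    rw [gaussianVec_forall_le (le_of_lt ht), neg_mul]

theorem integral_exp_neg_mul_one_sub_exp_neg_pow (k : ℕ) :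
    IntegrableOn (fun t : ℝ => exp (-t) * (1 - exp (-t)) ^ k) (Ioi 0) ∧
    ∫ t in Ioi (0 : ℝ), exp (-t) * (1 - exp (-t)) ^ k = 1 / (k + 1) := by
  have hderiv : ∀ t ∈ Ici (0 : ℝ), HasDerivAt (fun t : ℝ => (1 - exp (-t)) ^ (k + 1) / (k + 1))
      (exp (-t) * (1 - exp (-t)) ^ k) t := by
    intro t _
    have h1 : HasDerivAt (fun t : ℝ => 1 - exp (-t)) (exp (-t)) t := by
      convert! ((hasDerivAt_neg t).exp.const_sub 1) using 1
      ring
    convert! (h1.pow (k + 1)).div_const ((k : ℝ) + 1) using 1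
    have : (k : ℝ) + 1 ≠ 0 := by positivity
    push_cast
    field_simp
  have hpos : ∀ t ∈ Ioi (0 : ℝ), 0 ≤ exp (-t) * (1 - exp (-t)) ^ k := by
    intro t ht
    have : exp (-t) ≤ 1 := exp_le_one_iff.2 (by simpa using le_of_lt ht)
    have : 0 ≤ 1 - exp (-t) := by linarith
    positivity
  have hlim : Tendsto (fun t : ℝ => (1 - exp (-t)) ^ (k + 1) / (k + 1)) atTop
      (𝓝 (1 / (k + 1))) := by
    have h := ((tendsto_exp_neg_atTop_nhds_zero.const_sub 1).pow (k + 1)).div_const ((k : ℝ) + 1)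
    simpa using h
  refine ⟨integrableOn_Ioi_deriv_of_nonneg' hderiv hpos hlim, ?_⟩
  rw [integral_Ioi_of_hasDerivAt_of_nonneg' hderiv hpos hlim]
  simp

/-- In the layer-cake formula the tail `1 - (1 - exp (-t)) ^ d` is a finite geometric sum, whose
`k`-th term integrates to `1 / (k + 1)`. -/
theorem integral_maxEntry :
    ∫ x, maxEntry (sqModuli x) ∂(gaussianVec d) = ∑ k ∈ Finset.range d, 1 / ((k : ℝ) + 1) := by
  rw [integrable_maxEntry.integral_eq_integral_meas_le
    (ae_of_all _ fun x => maxEntry_nonneg (sqModuli_nonneg x))]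
  rw [setIntegral_congr_fun measurableSet_Ioi
    (g := fun t => ∑ k ∈ Finset.range d, exp (-t) * (1 - exp (-t)) ^ k)]
  · rw [integral_finsetSum _ fun k _ => (integral_exp_neg_mul_one_sub_exp_neg_pow k).1]
    exact Finset.sum_congr rfl fun k _ => (integral_exp_neg_mul_one_sub_exp_neg_pow k).2
  · intro t ht
    simp only [le_maxEntry_iff, sqModuli]
    rw [gaussianVec_exists_le (le_of_lt ht), ← Finset.mul_sum, ← mul_neg_geom_sum]
    ring

/-- Ensures that the greatest-component rule reaches far enough for every Werner operator that is a
state. -/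
theorem two_mul_div_le_sum_one_div (n : ℕ) :
    2 * (n : ℝ) / (n + 1) ≤ ∑ k ∈ Finset.range n, 1 / ((k : ℝ) + 1) := by
  induction n with
  | zero => simp
  | succ n ih =>
    rw [Finset.sum_range_succ]
    have : 2 * ((n + 1 : ℕ) : ℝ) / ((n + 1 : ℕ) + 1) ≤ 2 * (n : ℝ) / (n + 1) + 1 / (n + 1) := by
      push_cast
      rw [← add_div, div_le_div_iff₀ (by positivity) (by positivity)]
      nlinarith [(Nat.cast_nonneg n : (0 : ℝ) ≤ n)]
    linarith

/-- A permutation-equivariant stochastic rule selecting a component of a vector. -/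
structure IsResponse {d : ℕ} (q : (Fin d → ℝ) → Fin d → ℝ) : Prop where
  measurable : Measurable q
  nonneg : ∀ X i, 0 ≤ q X i
  sum_eq_one : ∀ X, ∑ i, q X i = 1
  comp_perm : ∀ X (σ : Equiv.Perm (Fin d)) i, q (X ∘ σ) i = q X (σ i)

open Classical in
/-- The indicator of the set of positions at which a vector takes its least value. -/
def argminIndicator {d : ℕ} (X : Fin d → ℝ) (i : Fin d) : ℝ := if ∀ j, X i ≤ X j then 1 else 0

/-- The rule selecting a position of the least component, uniformly among all such positions. -/
def argminResponse {d : ℕ} (X : Fin d → ℝ) (i : Fin d) : ℝ :=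
  argminIndicator X i / ∑ k, argminIndicator X k

theorem argminIndicator_nonneg {d : ℕ} (X : Fin d → ℝ) (i : Fin d) : 0 ≤ argminIndicator X i := by
  unfold argminIndicator; split_ifs <;> simp

theorem argminIndicator_mul (X : Fin d → ℝ) (i : Fin d) :
    argminIndicator X i * X i = argminIndicator X i * minEntry X := by
  unfold argminIndicator
  split_ifs with h
  · rw [one_mul, one_mul]
    exact le_antisymm (le_minEntry_iff.2 h) (minEntry_le X i)
  · simp

theorem sum_argminIndicator_pos (X : Fin d → ℝ) : 0 < ∑ k, argminIndicator X k := by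
  obtain ⟨i, -, hi⟩ := Finset.exists_mem_eq_inf' Finset.univ_nonempty X
  refine Finset.sum_pos' (fun j _ => argminIndicator_nonneg X j) ⟨i, Finset.mem_univ i, ?_⟩
  have : ∀ j, X i ≤ X j := fun j => hi ▸ minEntry_le X j
  simp [argminIndicator, this]

theorem measurable_argminIndicator {d : ℕ} (i : Fin d) :
    Measurable fun X : Fin d → ℝ => argminIndicator X i := by
  unfold argminIndicator
  refine Measurable.ite ?_ measurable_const measurable_const
  have : {X : Fin d → ℝ | ∀ j, X i ≤ X j} = ⋂ j, {X | X i ≤ X j} := by ext; simp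
  rw [this]
  exact MeasurableSet.iInter fun j =>
    measurableSet_le (measurable_pi_apply i) (measurable_pi_apply j)

theorem argminIndicator_comp_perm {d : ℕ} (X : Fin d → ℝ) (σ : Equiv.Perm (Fin d)) (i : Fin d) :
    argminIndicator (X ∘ σ) i = argminIndicator X (σ i) := by
  have : (∀ j, (X ∘ σ) i ≤ (X ∘ σ) j) ↔ ∀ j, X (σ i) ≤ X j :=
    (σ.surjective.forall (p := fun j => X (σ i) ≤ X j)).symm
  simp only [argminIndicator, this]

theorem isResponse_argminResponse : IsResponse (argminResponse (d := d)) where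
  measurable := measurable_pi_lambda _ fun i => (measurable_argminIndicator i).div
    (Finset.measurable_fun_sum _ fun k _ => measurable_argminIndicator k)
  nonneg X i := div_nonneg (argminIndicator_nonneg X i) (sum_argminIndicator_pos X).le
  sum_eq_one X := by
    simp only [argminResponse]
    rw [← Finset.sum_div, div_self (sum_argminIndicator_pos X).ne']
  comp_perm X σ i := by
    simp only [argminResponse, argminIndicator_comp_perm]
    rw [Equiv.sum_comp σ]

theorem sum_argminResponse_mul (X : Fin d → ℝ) : ∑ i, argminResponse X i * X i = minEntry X := by
  simp only [argminResponse, div_mul_eq_mul_div, argminIndicator_mul]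
  rw [← Finset.sum_div, ← Finset.sum_mul,
    mul_div_cancel_left₀ _ (sum_argminIndicator_pos X).ne']

/-- The rule selecting a position of the least component with probability `t`, and one of the
greatest component with probability `1 - t`. -/
def mixedResponse {d : ℕ} (t : ℝ) (X : Fin d → ℝ) (i : Fin d) : ℝ :=
  t * argminResponse X i + (1 - t) * argminResponse (-X) i

theorem isResponse_mixedResponse {t : ℝ} (h0 : 0 ≤ t) (h1 : t ≤ 1) :
    IsResponse (mixedResponse (d := d) t) where
  measurable := by
    have h := (isResponse_argminResponse (d := d)).measurable
    have h' : Measurable fun X : Fin d → ℝ => argminResponse (-X) := h.comp measurable_neg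
    exact measurable_pi_lambda _ fun i =>
      (((measurable_pi_apply i).comp h).const_mul t).add
        (((measurable_pi_apply i).comp h').const_mul (1 - t))
  nonneg X i := add_nonneg (mul_nonneg h0 (isResponse_argminResponse.nonneg X i))
    (mul_nonneg (sub_nonneg.2 h1) (isResponse_argminResponse.nonneg (-X) i))
  sum_eq_one X := by
    simp only [mixedResponse, Finset.sum_add_distrib, ← Finset.mul_sum,
      isResponse_argminResponse.sum_eq_one]
    ring
  comp_perm X σ i := by
    have : -(X ∘ σ) = (-X) ∘ σ := rfl
    simp only [mixedResponse, this, isResponse_argminResponse.comp_perm]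

theorem sum_mixedResponse_mul (t : ℝ) (X : Fin d → ℝ) :
    ∑ i, mixedResponse t X i * X i = t * minEntry X + (1 - t) * maxEntry X := by
  have h := sum_argminResponse_mul (-X)
  simp only [minEntry_neg, Pi.neg_apply, mul_neg, Finset.sum_neg_distrib, neg_inj] at h
  rw [← h, ← sum_argminResponse_mul X, Finset.mul_sum, Finset.mul_sum, ← Finset.sum_add_distrib]
  exact Finset.sum_congr rfl fun i _ => by simp only [mixedResponse]; ring

/-- Every value between `1 / d` and `2 d / (d + 1)` is the expected squared modulus of the
component selected by some response to a Gaussian vector. -/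
theorem exists_response {s : ℝ} (hd : 2 ≤ d) (h1 : 1 / (d : ℝ) ≤ s) (h2 : s ≤ 2 * d / (d + 1)) :
    ∃ q : (Fin d → ℝ) → Fin d → ℝ, IsResponse q ∧
      ∫ x, ∑ i, q (sqModuli x) i * sqModuli x i ∂(gaussianVec d) = s := by
  set H := ∑ k ∈ Finset.range d, 1 / ((k : ℝ) + 1) with hH
  have hsH : s ≤ H := h2.trans (two_mul_div_le_sum_one_div d)
  have hd' : (2 : ℝ) ≤ d := by exact_mod_cast hd
  have hlt : 1 / (d : ℝ) < H := by
    refine lt_of_lt_of_le ?_ (two_mul_div_le_sum_one_div d)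
    rw [div_lt_div_iff₀ (by positivity) (by positivity)]
    nlinarith
  have hpos : 0 < H - 1 / d := sub_pos.2 hlt
  -- The solution of `t / d + (1 - t) * H = s`, the two expectations being those of the minimum and
  -- the maximum.
  set t := (H - s) / (H - 1 / d) with ht
  refine ⟨mixedResponse t, isResponse_mixedResponse ?_ ?_, ?_⟩
  · exact div_nonneg (sub_nonneg.2 hsH) hpos.le
  · rw [ht, div_le_one hpos]; linarith
  · simp only [sum_mixedResponse_mul]
    rw [integral_add (integrable_minEntry.const_mul _) (integrable_maxEntry.const_mul _),
      integral_const_mul, integral_const_mul, integral_minEntry, integral_maxEntry, ← hH]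
    have : t * (H - 1 / d) = H - s := div_mul_cancel₀ _ hpos.ne'
    linarith

end responses

/-! ### Second moments weighted by a response. -/

section moments

variable {d : ℕ}

theorem permMatrix_mem_unitaryGroup (σ : Equiv.Perm (Fin d)) :
    σ.permMatrix ℂ ∈ Matrix.unitaryGroup (Fin d) ℂ := by
  rw [Matrix.mem_unitaryGroup_iff, Matrix.star_eq_conjTranspose, Matrix.conjTranspose_permMatrix,
    ← Matrix.permMatrix_mul]
  simp

theorem measurePreserving_comp_perm (σ : Equiv.Perm (Fin d)) :
    MeasurePreserving (fun x : Fin d → ℂ => x ∘ σ) (gaussianVec d) (gaussianVec d) := by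
  have h := measurePreserving_mulVec (permMatrix_mem_unitaryGroup σ)
  have e : (σ.permMatrix ℂ).mulVec = fun x : Fin d → ℂ => x ∘ σ := by
    funext x; exact Matrix.permMatrix_mulVec σ
  rwa [e] at h

/-- The sign change of one component, as a diagonal matrix. -/
def signFlip (j : Fin d) : Matrix (Fin d) (Fin d) ℂ :=
  Matrix.diagonal fun k => if k = j then -1 else 1

theorem signFlip_mem_unitaryGroup (j : Fin d) :
    signFlip j ∈ Matrix.unitaryGroup (Fin d) ℂ := by
  rw [Matrix.mem_unitaryGroup_iff, Matrix.star_eq_conjTranspose, signFlip,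
    Matrix.diagonal_conjTranspose, Matrix.diagonal_mul_diagonal, ← Matrix.diagonal_one]
  congr 1
  funext k
  simp only [Pi.star_apply]
  split_ifs <;> simp

theorem signFlip_mulVec (j : Fin d) (x : Fin d → ℂ) (k : Fin d) :
    (signFlip j).mulVec x k = (if k = j then -1 else 1) * x k := by
  rw [signFlip, Matrix.mulVec_diagonal]

theorem sqModuli_signFlip_mulVec (j : Fin d) (x : Fin d → ℂ) :
    sqModuli ((signFlip j).mulVec x) = sqModuli x := by
  funext k
  simp only [sqModuli, signFlip_mulVec]
  split_ifs <;> simp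

theorem integral_comp_mulVec {U : Matrix (Fin d) (Fin d) ℂ}
    (hU : U ∈ Matrix.unitaryGroup (Fin d) ℂ) {f : (Fin d → ℂ) → ℂ} (hf : Measurable f) :
    ∫ x, f (U.mulVec x) ∂(gaussianVec d) = ∫ x, f x ∂(gaussianVec d) := by
  have h := measurePreserving_mulVec hU
  conv_rhs => rw [← h.map_eq]
  exact (integral_map h.measurable.aemeasurable hf.aestronglyMeasurable).symm

variable {q : (Fin d → ℝ) → Fin d → ℝ}

theorem IsResponse.le_one (hq : IsResponse q) (X : Fin d → ℝ) (i : Fin d) : q X i ≤ 1 :=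
  (hq.sum_eq_one X) ▸ Finset.single_le_sum (fun j _ => hq.nonneg X j) (Finset.mem_univ i)

theorem IsResponse.measurable_comp (hq : IsResponse q) (i : Fin d) :
    Measurable fun x : Fin d → ℂ => q (sqModuli x) i :=
  (measurable_pi_apply i).comp (hq.measurable.comp measurable_sqModuli)

theorem IsResponse.integrable_mul_sqModuli (hq : IsResponse q) (i j : Fin d) :
    Integrable (fun x => q (sqModuli x) i * sqModuli x j) (gaussianVec d) := by
  refine (integrable_norm_sq_apply j).mono'
    ((hq.measurable_comp i).mul (by unfold sqModuli; fun_prop)).aestronglyMeasurable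
    (ae_of_all _ fun x => ?_)
  rw [norm_eq_abs, abs_of_nonneg (mul_nonneg (hq.nonneg _ _) (sqModuli_nonneg x j))]
  exact mul_le_of_le_one_left (sqModuli_nonneg x j) (hq.le_one _ _)

theorem IsResponse.integrable_mul_mul_conj (hq : IsResponse q) (i j k : Fin d) :
    Integrable (fun x => (q (sqModuli x) i : ℂ) * (x j * star (x k))) (gaussianVec d) := by
  have hm : Measurable fun x : Fin d → ℂ => (q (sqModuli x) i : ℂ) :=
    Complex.measurable_ofReal.comp (hq.measurable_comp i)
  refine ((integrable_norm_sq_apply j).add (integrable_norm_sq_apply k)).mono'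
    (hm.mul (by simp only [RCLike.star_def]; fun_prop)).aestronglyMeasurable (ae_of_all _ fun x => ?_)
  rw [norm_mul, norm_mul, norm_star, Complex.norm_real, norm_eq_abs,
    abs_of_nonneg (hq.nonneg _ _)]
  calc q (sqModuli x) i * (‖x j‖ * ‖x k‖) ≤ ‖x j‖ * ‖x k‖ :=
        mul_le_of_le_one_left (by positivity) (hq.le_one _ _)
    _ ≤ ‖x j‖ ^ 2 + ‖x k‖ ^ 2 := by nlinarith [sq_nonneg (‖x j‖ - ‖x k‖), sq_nonneg (‖x j‖ + ‖x k‖)]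

/-- Equivariance of the rule and exchangeability of the components leave just two distinct moments,
`i = j` and `i ≠ j`. The first is `s / d`; the second follows because the weights add to one and
each component has mean square one. -/
theorem IsResponse.integral_perm (hq : IsResponse q) (σ : Equiv.Perm (Fin d)) (i j : Fin d) :
    ∫ x, q (sqModuli x) (σ i) * sqModuli x (σ j) ∂(gaussianVec d) =
      ∫ x, q (sqModuli x) i * sqModuli x j ∂(gaussianVec d) := by
  have h := measurePreserving_comp_perm σ
  have hm := (hq.integrable_mul_sqModuli i j).aestronglyMeasurable
  rw [← h.map_eq] at hm
  conv_rhs => rw [← h.map_eq]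
  rw [integral_map h.measurable.aemeasurable hm]
  refine integral_congr_ae (ae_of_all _ fun x => ?_)
  have : sqModuli (x ∘ σ) = sqModuli x ∘ σ := rfl
  simp only [this, hq.comp_perm, Function.comp_apply]

theorem IsResponse.integral_mul_sqModuli_self (hq : IsResponse q) {s : ℝ}
    (hs : ∫ x, ∑ i, q (sqModuli x) i * sqModuli x i ∂(gaussianVec d) = s) (i : Fin d) :
    ∫ x, q (sqModuli x) i * sqModuli x i ∂(gaussianVec d) = s / d := by
  rw [integral_finsetSum _ fun j _ => hq.integrable_mul_sqModuli j j] at hs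
  have h : ∀ j, ∫ x, q (sqModuli x) j * sqModuli x j ∂(gaussianVec d) =
      ∫ x, q (sqModuli x) i * sqModuli x i ∂(gaussianVec d) := fun j => by
    simpa using (hq.integral_perm (Equiv.swap i j) i i)
  simp only [h, Finset.sum_const, Finset.card_univ, Fintype.card_fin, nsmul_eq_mul] at hs
  have hd : (d : ℝ) ≠ 0 := Nat.cast_ne_zero.2 (by have := i.2; omega)
  rw [← hs, mul_div_cancel_left₀ _ hd]

theorem IsResponse.integral_mul_sqModuli_of_ne (hq : IsResponse q) {s : ℝ}
    (hs : ∫ x, ∑ i, q (sqModuli x) i * sqModuli x i ∂(gaussianVec d) = s) {i j : Fin d}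
    (hij : i ≠ j) :
    ∫ x, q (sqModuli x) i * sqModuli x j ∂(gaussianVec d) = (1 - s / d) / (d - 1) := by
  have htot : ∑ k, ∫ x, q (sqModuli x) k * sqModuli x j ∂(gaussianVec d) = 1 := by
    rw [← integral_finsetSum _ fun k _ => hq.integrable_mul_sqModuli k j]
    simp only [← Finset.sum_mul, hq.sum_eq_one, one_mul]
    exact integral_norm_sq_apply j
  have h : ∀ k ∈ Finset.univ.erase j, ∫ x, q (sqModuli x) k * sqModuli x j ∂(gaussianVec d) =
      ∫ x, q (sqModuli x) i * sqModuli x j ∂(gaussianVec d) := by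
    intro k hk
    have hkj := (Finset.mem_erase.1 hk).1
    have := hq.integral_perm (Equiv.swap i k) i j
    rwa [Equiv.swap_apply_left, Equiv.swap_apply_of_ne_of_ne hij.symm hkj.symm] at this
  rw [← Finset.add_sum_erase _ _ (Finset.mem_univ j), hq.integral_mul_sqModuli_self hs,
    Finset.sum_congr rfl h, Finset.sum_const, Finset.card_erase_of_mem (Finset.mem_univ j),
    Finset.card_univ, Fintype.card_fin, nsmul_eq_mul] at htot
  have hd : 2 ≤ d := by
    have := i.2; have := j.2
    have : (i : ℕ) ≠ j := fun h => hij (Fin.ext h)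
    omega
  have hd' : (2 : ℝ) ≤ d := by exact_mod_cast hd
  rw [Nat.cast_sub (by omega), Nat.cast_one] at htot
  rw [eq_div_iff (by linarith)]
  linarith

/-- Off-diagonal moments vanish since changing the sign of `x j` preserves both the measure and the
response but negates the integrand. -/
theorem IsResponse.integral_mul_mul_conj (hq : IsResponse q) {s : ℝ}
    (hs : ∫ x, ∑ i, q (sqModuli x) i * sqModuli x i ∂(gaussianVec d) = s) (i j k : Fin d) :
    ∫ x, (q (sqModuli x) i : ℂ) * (x j * star (x k)) ∂(gaussianVec d) =
      if j = k then (if i = j then ((s / d : ℝ) : ℂ) else (((1 - s / d) / (d - 1) : ℝ) : ℂ))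
      else 0 := by
  split_ifs with hjk hij
  · subst hjk hij
    rw [← hq.integral_mul_sqModuli_self hs i, ← integral_complex_ofReal]
    refine integral_congr_ae (ae_of_all _ fun x => ?_)
    simp [sqModuli, Complex.mul_conj']
  · subst hjk
    rw [← hq.integral_mul_sqModuli_of_ne hs hij, ← integral_complex_ofReal]
    refine integral_congr_ae (ae_of_all _ fun x => ?_)
    simp [sqModuli, Complex.mul_conj']
  · have hm : Measurable fun x : Fin d → ℂ => (q (sqModuli x) i : ℂ) :=
      Complex.measurable_ofReal.comp (hq.measurable_comp i)
    have h := integral_comp_mulVec (signFlip_mem_unitaryGroup j)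
      (f := fun x => (q (sqModuli x) i : ℂ) * (x j * star (x k)))
      (hm.mul (by simp only [RCLike.star_def]; fun_prop))
    simp only [sqModuli_signFlip_mulVec, signFlip_mulVec, if_true, if_neg (Ne.symm hjk),
      one_mul, neg_mul, mul_neg, integral_neg] at h
    exact self_eq_neg.1 h.symm

/-- The weighted second moments of a Gaussian vector, the weight being the response to its
components with respect to an arbitrary orthonormal basis. -/
theorem IsResponse.integral_mul_mul_conj_unitary (hq : IsResponse q) {s : ℝ}
    (hs : ∫ x, ∑ i, q (sqModuli x) i * sqModuli x i ∂(gaussianVec d) = s)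
    {U : Matrix (Fin d) (Fin d) ℂ} (hU : U ∈ Matrix.unitaryGroup (Fin d) ℂ) (i j k : Fin d) :
    Integrable (fun x => (q (sqModuli ((star U).mulVec x)) i : ℂ) * (x j * star (x k)))
      (gaussianVec d) ∧
    ∫ x, (q (sqModuli ((star U).mulVec x)) i : ℂ) * (x j * star (x k)) ∂(gaussianVec d) =
      (((1 - s / d) / (d - 1) : ℝ) : ℂ) * (1 : Matrix (Fin d) (Fin d) ℂ) j k +
      ((s / d - (1 - s / d) / (d - 1) : ℝ) : ℂ) * (U j i * star (U k i)) := by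
  have hmv : ∀ V : Matrix (Fin d) (Fin d) ℂ, Measurable V.mulVec := fun V =>
    (Continuous.matrix_mulVec continuous_const continuous_id).measurable
  have hm : Measurable fun x : Fin d → ℂ => (q (sqModuli ((star U).mulVec x)) i : ℂ) :=
    Complex.measurable_ofReal.comp ((hq.measurable_comp i).comp (hmv _))
  have hmf : Measurable fun x : Fin d → ℂ =>
      (q (sqModuli ((star U).mulVec x)) i : ℂ) * (x j * star (x k)) :=
    hm.mul (by simp only [RCLike.star_def]; fun_prop)
  -- After substituting `U.mulVec x` for `x`, the response sees the standard components only, and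
  -- the computed moments apply.
  have hcomp : ∀ x : Fin d → ℂ, (q (sqModuli ((star U).mulVec (U.mulVec x))) i : ℂ) *
      (U.mulVec x j * star (U.mulVec x k)) =
      ∑ a, ∑ b, U j a * star (U k b) * ((q (sqModuli x) i : ℂ) * (x a * star (x b))) := by
    intro x
    rw [Matrix.mulVec_mulVec, Matrix.mem_unitaryGroup_iff'.1 hU, Matrix.one_mulVec]
    simp only [Matrix.mulVec, dotProduct, star_sum, star_mul']
    rw [Finset.sum_mul_sum]
    simp only [Finset.mul_sum]
    exact Finset.sum_congr rfl fun a _ => Finset.sum_congr rfl fun b _ => by ring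
  have hint : ∀ a b, Integrable (fun x : Fin d → ℂ =>
      U j a * star (U k b) * ((q (sqModuli x) i : ℂ) * (x a * star (x b)))) (gaussianVec d) :=
    fun a b => (hq.integrable_mul_mul_conj i a b).const_mul _
  refine ⟨?_, ?_⟩
  · have h := measurePreserving_mulVec hU
    rw [← h.map_eq, integrable_map_measure hmf.aestronglyMeasurable h.measurable.aemeasurable]
    have : (fun x : Fin d → ℂ =>
        (q (sqModuli ((star U).mulVec x)) i : ℂ) * (x j * star (x k))) ∘ U.mulVec =
        fun x => ∑ a, ∑ b, U j a * star (U k b) * ((q (sqModuli x) i : ℂ) * (x a * star (x b))) :=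
      funext hcomp
    rw [this]
    exact integrable_finsetSum _ fun a _ => integrable_finsetSum _ fun b _ => hint a b
  · rw [← integral_comp_mulVec hU hmf]
    simp only [hcomp]
    rw [integral_finsetSum _ fun a _ => integrable_finsetSum _ fun b _ => hint a b]
    have h1 : ∀ a, ∫ x, ∑ b, U j a * star (U k b) *
        ((q (sqModuli x) i : ℂ) * (x a * star (x b))) ∂(gaussianVec d) =
        (((1 - s / d) / (d - 1) : ℝ) : ℂ) * (U j a * star (U k a)) +
        if i = a then ((s / d - (1 - s / d) / (d - 1) : ℝ) : ℂ) * (U j a * star (U k a))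
        else 0 := by
      intro a
      rw [integral_finsetSum _ fun b _ => hint a b]
      simp only [integral_const_mul, hq.integral_mul_mul_conj hs]
      rw [Finset.sum_eq_single a (fun b _ hb => by simp [hb.symm]) (by simp)]
      rw [if_pos rfl]
      split_ifs <;> push_cast <;> ring
    simp only [h1, Finset.sum_add_distrib, ← Finset.mul_sum, Finset.sum_ite_eq, Finset.mem_univ,
      if_true]
    congr 2
    rw [← Matrix.mem_unitaryGroup_iff.1 hU, Matrix.mul_apply]
    rfl

end moments

/-! ### Observables in terms of an eigenbasis. -/

section observables

variable {n : Type*} [Fintype n] [DecidableEq n]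

/-- The Hermitian matrix with eigenvalues `l i` and eigenvectors the columns of `U`. -/
def ofEigen (U : Matrix.unitaryGroup n ℂ) (l : n → ℝ) : Observable n :=
  ⟨U.1 * Matrix.diagonal (fun i => (l i : ℂ)) * star U.1, by
    have : (Matrix.diagonal fun i => (l i : ℂ)).IsHermitian := by
      rw [Matrix.isHermitian_diagonal_iff]
      intro i
      simp [isSelfAdjoint_iff]
    rw [Matrix.star_eq_conjTranspose]
    exact Matrix.isHermitian_mul_mul_conjTranspose _ this⟩

theorem exists_eq_ofEigen (A : Observable n) : ∃ U l, A = ofEigen U l := by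
  refine ⟨A.2.eigenvectorUnitary, A.2.eigenvalues, Subtype.ext ?_⟩
  conv_lhs => rw [A.2.spectral_theorem]
  rfl

theorem outcomes_ofEigen (U : Matrix.unitaryGroup n ℂ) (l : n → ℝ) :
    (ofEigen U l).outcomes = Finset.univ.image l := by
  have h : spectrum ℝ (ofEigen U l).1 = Set.range l := by
    have e : (ofEigen U l).1 = Unitary.conjStarAlgAut ℂ _ U
        (Matrix.diagonal fun i => (l i : ℂ)) := rfl
    ext x
    rw [e, ← spectrum.algebraMap_mem_iff ℂ]
    simp
  ext x
  simp [Observable.outcomes, h]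

theorem diagonal_mulVec_of_eigenvector {l : n → ℝ} {a : ℝ} {y : n → ℂ}
    (hy : (Matrix.diagonal fun i => (l i : ℂ)).mulVec y = (a : ℂ) • y) :
    (Matrix.diagonal fun i => if l i = a then (1 : ℂ) else 0).mulVec y = y := by
  funext i
  have h := congrFun hy i
  rw [Matrix.mulVec_diagonal] at h
  rw [Matrix.mulVec_diagonal]
  split_ifs with hi
  · simp
  · have h2 : ((l i : ℂ) - a) * y i = 0 := by
      rw [sub_mul, h]; simp
    rcases mul_eq_zero.1 h2 with h3 | h3
    · exact absurd (by exact_mod_cast sub_eq_zero.1 h3) hi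
    · simp [h3]

/-- The orthogonal projection is characterised by two properties checked here: its values lie in the
eigenspace, and the residual is orthogonal to it. The second holds because the candidate matrix is
Hermitian and fixes every eigenvector. -/
theorem projector_ofEigen (U : Matrix.unitaryGroup n ℂ) (l : n → ℝ) (a : ℝ) :
    (ofEigen U l).projector a =
      U.1 * Matrix.diagonal (fun i => if l i = a then (1 : ℂ) else 0) * star U.1 := by
  set D := Matrix.diagonal (fun i => (l i : ℂ)) with hD
  set E := Matrix.diagonal (fun i => if l i = a then (1 : ℂ) else 0) with hE
  have hUU : star U.1 * U.1 = 1 := Matrix.mem_unitaryGroup_iff'.1 U.2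
  have hUU' : U.1 * star U.1 = 1 := Matrix.mem_unitaryGroup_iff.1 U.2
  have hDE : D * E = (a : ℂ) • E := by
    rw [hD, hE, Matrix.diagonal_mul_diagonal, ← Matrix.diagonal_smul]
    congr 1
    funext i
    by_cases h : l i = a <;> simp [h]
  have hP : (U.1 * E * star U.1).IsHermitian := by
    rw [Matrix.star_eq_conjTranspose]
    refine Matrix.isHermitian_mul_mul_conjTranspose _ ?_
    rw [hE, Matrix.isHermitian_diagonal_iff]
    intro i
    split_ifs <;> simp [isSelfAdjoint_iff]
  rw [Observable.projector, StarAlgEquiv.symm_apply_eq]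
  refine ContinuousLinearMap.ext fun x => ?_
  refine Submodule.eq_starProjection_of_mem_of_inner_eq_zero ?_ fun w hw => ?_
  · rw [Module.End.mem_eigenspace_iff]
    refine WithLp.ofLp_injective 2 ?_
    rw [Matrix.ofLp_toLpLin, Matrix.toLin'_apply, WithLp.ofLp_smul, Matrix.ofLp_toEuclideanCLM,
      Matrix.mulVec_mulVec, ← Matrix.smul_mulVec]
    congr 1
    calc (ofEigen U l).1 * (U.1 * E * star U.1)
        = U.1 * D * (star U.1 * U.1) * E * star U.1 := by
          simp only [ofEigen, ← hD, Matrix.mul_assoc]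
      _ = (a : ℂ) • (U.1 * E * star U.1) := by
          rw [hUU, Matrix.mul_one, Matrix.mul_assoc U.1, hDE]
          simp
  · rw [Module.End.mem_eigenspace_iff] at hw
    have hw' : (ofEigen U l).1.mulVec w.ofLp = (a : ℂ) • w.ofLp := by
      rw [← Matrix.toLin'_apply, ← Matrix.ofLp_toLpLin 2 2, hw, WithLp.ofLp_smul]
    have hy : D.mulVec ((star U.1).mulVec w.ofLp) = (a : ℂ) • (star U.1).mulVec w.ofLp := by
      rw [← Matrix.mulVec_smul, ← hw']
      simp only [ofEigen, ← hD, Matrix.mulVec_mulVec]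
      rw [← Matrix.mul_assoc, ← Matrix.mul_assoc, hUU, Matrix.one_mul]
    have hPw : (U.1 * E * star U.1).mulVec w.ofLp = w.ofLp := by
      rw [← Matrix.mulVec_mulVec, ← Matrix.mulVec_mulVec, diagonal_mulVec_of_eigenvector hy,
        Matrix.mulVec_mulVec, hUU', Matrix.one_mulVec]
    rw [inner_sub_left, sub_eq_zero]
    simp only [EuclideanSpace.inner_eq_star_dotProduct, Matrix.ofLp_toEuclideanCLM]
    rw [Matrix.star_mulVec, hP.eq, dotProduct_comm, dotProduct_comm w.ofLp,
      ← Matrix.dotProduct_mulVec, hPw]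

theorem projector_ofEigen_apply (U : Matrix.unitaryGroup n ℂ) (l : n → ℝ) (a : ℝ) (j k : n) :
    (ofEigen U l).projector a j k =
      ∑ i, if l i = a then U.1 j i * star (U.1 k i) else 0 := by
  rw [projector_ofEigen, Matrix.mul_apply]
  simp only [Matrix.mul_diagonal, Matrix.star_apply, mul_ite, mul_one, mul_zero, ite_mul, zero_mul]

theorem trace_projector_ofEigen (U : Matrix.unitaryGroup n ℂ) (l : n → ℝ) (a : ℝ) :
    ((ofEigen U l).projector a).trace = ∑ i, if l i = a then (1 : ℂ) else 0 := by
  rw [projector_ofEigen, Matrix.trace_mul_comm, ← Matrix.mul_assoc,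
    Matrix.mem_unitaryGroup_iff'.1 U.2, Matrix.one_mul, Matrix.trace_diagonal]

end observables

/-! ### Conditioned states and the positivity range of `η`. -/

theorem condState_wernerState (d : ℕ) (η : ℝ) (A : Observable (Fin d)) (a : ℝ) (i j : Fin d) :
    condState (wernerState d η) A a i j =
      ((((d : ℝ) - 1 + η) / ((d : ℝ) - 1) / (d : ℝ) ^ 2 : ℝ) : ℂ) *
        ((A.projector a).trace * (1 : Matrix (Fin d) (Fin d) ℂ) i j) -
      ((η / ((d : ℝ) - 1) / (d : ℝ) : ℝ) : ℂ) * A.projector a i j := by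
  unfold condState
  generalize A.projector a = P
  rw [wernerState, Matrix.sub_mul, Matrix.smul_mul, Matrix.smul_mul, Matrix.one_mul]
  simp only [partialTraceA, Matrix.of_apply, Matrix.sub_apply, Matrix.smul_apply, smul_eq_mul,
    Finset.sum_sub_distrib, ← Finset.mul_sum]
  congr 2
  · simp only [Matrix.kroneckerMap_apply, Matrix.one_apply, Matrix.trace, Matrix.diag_apply,
      Finset.sum_mul]
  -- The partial trace of `V (P ⊗ 1)` is `P`: the flip and the identity factor leave a single
  -- nonzero term.
  · simp only [Matrix.mul_apply, Fintype.sum_prod_type, flipOperator, Matrix.of_apply,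
      Matrix.kroneckerMap_apply, Prod.swap_prod_mk, Prod.mk.injEq, Matrix.one_apply]
    rw [Finset.sum_eq_single j, Finset.sum_eq_single i, Finset.sum_eq_single j]
    · simp
    · intro b _ hb; simp [hb]
    · simp
    · intro b _ hb; simp [hb.symm]
    · simp
    · intro b _ hb
      refine Finset.sum_eq_zero fun x _ => Finset.sum_eq_zero fun y _ => ?_
      by_cases h : y = j
      · subst h; simp [hb]
      · simp [h]
    · simp

/-- Testing positivity on the antisymmetric vector `e₀ ⊗ e₁ - e₁ ⊗ e₀`, on which the flip acts as
`-1`, gives `η ≥ -(d - 1) / (d + 1)`. -/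
theorem le_of_isState_wernerState {d : ℕ} (hd : 2 ≤ d) {η : ℝ} (hW : IsState (wernerState d η)) :
    1 - η ≤ 2 * d / (d + 1) := by
  have hd' : (2 : ℝ) ≤ d := by exact_mod_cast hd
  let i0 : Fin d := ⟨0, by omega⟩
  let i1 : Fin d := ⟨1, by omega⟩
  have h01 : i0 ≠ i1 := by simp [i0, i1]
  have h := hW.1.dotProduct_mulVec_nonneg (Pi.single (i0, i1) 1 - Pi.single (i1, i0) 1)
  have e : star (Pi.single (i0, i1) 1 - Pi.single (i1, i0) 1 : Fin d × Fin d → ℂ) ⬝ᵥ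
      (wernerState d η).mulVec (Pi.single (i0, i1) 1 - Pi.single (i1, i0) 1) =
      ((2 * (((d : ℝ) - 1 + η) / ((d : ℝ) - 1) / (d : ℝ) ^ 2 + η / ((d : ℝ) - 1) / d) : ℝ) : ℂ) := by
    simp only [star_sub, Matrix.mulVec_sub, Matrix.mulVec_single_one, sub_dotProduct,
      dotProduct_sub, Pi.star_single, star_one, single_dotProduct, one_mul, Matrix.col_apply]
    simp [wernerState, flipOperator, h01, h01.symm]
    ring
  rw [e] at h
  have h' : 0 ≤ 2 * (((d : ℝ) - 1 + η) / ((d : ℝ) - 1) / (d : ℝ) ^ 2 + η / ((d : ℝ) - 1) / d) := by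
    exact_mod_cast h
  have e2 : 2 * (((d : ℝ) - 1 + η) / ((d : ℝ) - 1) / (d : ℝ) ^ 2 + η / ((d : ℝ) - 1) / d) =
      2 * (d - 1 + η * (d + 1)) / ((d - 1) * d ^ 2) := by
    have : (d : ℝ) - 1 ≠ 0 := by linarith
    field_simp
    ring
  have hpos : 0 < ((d : ℝ) - 1) * d ^ 2 := mul_pos (by linarith) (by positivity)
  rw [e2, le_div_iff₀ hpos] at h'
  rw [le_div_iff₀ (by positivity)]
  linarith

/-! ### The hidden ensemble and the local model. -/

/-- The Gaussian measure on `ℂᵈ`, weighted with the squared norm. -/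
def weightedGaussian (d : ℕ) : Measure (Fin d → ℂ) :=
  (gaussianVec d).withDensity fun x => ENNReal.ofReal ((∑ i, sqModuli x i) / d)

theorem isProbabilityMeasure_weightedGaussian {d : ℕ} (hd : d ≠ 0) :
    IsProbabilityMeasure (weightedGaussian d) := by
  constructor
  rw [weightedGaussian, withDensity_apply _ MeasurableSet.univ, Measure.restrict_univ,
    ← ofReal_integral_eq_lintegral_ofReal (integrable_sum_sqModuli.div_const _)
      (ae_of_all _ fun x => div_nonneg
        (Finset.sum_nonneg fun i _ => sqModuli_nonneg x i) (Nat.cast_nonneg d)),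
    integral_div]
  simp only [sqModuli]
  rw [integral_finsetSum _ fun i _ => integrable_norm_sq_apply i]
  simp only [integral_norm_sq_apply]
  simp [hd]

theorem integral_weightedGaussian {d : ℕ} (f : (Fin d → ℂ) → ℂ) :
    ∫ x, f x ∂(weightedGaussian d) =
      (∫ x, f x * ((∑ i, sqModuli x i : ℝ) : ℂ) ∂(gaussianVec d)) / d := by
  have hm : Measurable fun x : Fin d → ℂ => ENNReal.ofReal ((∑ i, sqModuli x i) / d) := by
    unfold sqModuli; fun_prop
  rw [weightedGaussian, integral_withDensity_eq_integral_toReal_smul hm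
    (ae_of_all _ fun x => ENNReal.ofReal_lt_top), ← integral_div]
  refine integral_congr_ae (ae_of_all _ fun x => ?_)
  have h0 : 0 ≤ (∑ i, sqModuli x i) / d := div_nonneg
    (Finset.sum_nonneg fun i _ => sqModuli_nonneg x i) (Nat.cast_nonneg d)
  simp only [ENNReal.toReal_ofReal h0, Complex.real_smul]
  push_cast
  ring

open Classical in
/-- The pure state with state vector proportional to `x`, with a convention for `x = 0`. -/
def pureState {d : ℕ} (x : Fin d → ℂ) : Matrix (Fin d) (Fin d) ℂ :=
  if x = 0 then ((d : ℂ)⁻¹) • 1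
  else (((∑ i, sqModuli x i)⁻¹ : ℝ) : ℂ) • Matrix.vecMulVec x (star x)

theorem sum_sqModuli_pos {d : ℕ} {x : Fin d → ℂ} (hx : x ≠ 0) : 0 < ∑ i, sqModuli x i := by
  obtain ⟨i, hi⟩ := Function.ne_iff.1 hx
  refine Finset.sum_pos' (fun j _ => sqModuli_nonneg x j) ⟨i, Finset.mem_univ i, ?_⟩
  have : 0 < ‖x i‖ := norm_pos_iff.2 hi
  simp only [sqModuli]
  positivity

theorem isState_pureState {d : ℕ} (hd : d ≠ 0) (x : Fin d → ℂ) : IsState (pureState x) := by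
  unfold pureState
  split_ifs with hx
  · refine ⟨Matrix.PosSemidef.one.smul ?_, ?_⟩
    · rw [← Complex.ofReal_natCast, ← Complex.ofReal_inv]
      exact Complex.zero_le_real.2 (by positivity)
    · rw [Matrix.trace_smul, Matrix.trace_one, Fintype.card_fin, smul_eq_mul,
        inv_mul_cancel₀ (Nat.cast_ne_zero.2 hd)]
  · have hpos := sum_sqModuli_pos hx
    refine ⟨(Matrix.posSemidef_vecMulVec_self_star x).smul
      (Complex.zero_le_real.2 (inv_pos.2 hpos).le), ?_⟩
    rw [Matrix.trace_smul, Matrix.trace_vecMulVec]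
    have : x ⬝ᵥ star x = ((∑ i, sqModuli x i : ℝ) : ℂ) := by
      simp [dotProduct, sqModuli, Complex.mul_conj']
    rw [this, smul_eq_mul, ← Complex.ofReal_mul, inv_mul_cancel₀ hpos.ne', Complex.ofReal_one]

/-- The weight in `weightedGaussian` cancels the normalisation of the pure state, so the integrals
of the model become plain Gaussian second moments. Both sides vanish at `x = 0`, so the convention
there is harmless. -/
theorem pureState_apply_mul {d : ℕ} (x : Fin d → ℂ) (j k : Fin d) :
    pureState x j k * ((∑ i, sqModuli x i : ℝ) : ℂ) = x j * star (x k) := by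
  unfold pureState
  split_ifs with hx
  · simp [hx, sqModuli]
  · have hpos : ((∑ i, sqModuli x i : ℝ) : ℂ) ≠ 0 :=
      Complex.ofReal_ne_zero.2 (sum_sqModuli_pos hx).ne'
    rw [Matrix.smul_apply, Matrix.vecMulVec_apply, Complex.ofReal_inv, smul_eq_mul, mul_comm,
      ← mul_assoc, mul_inv_cancel₀ hpos, one_mul]
    rfl

theorem measurable_pureState_apply {d : ℕ} (j k : Fin d) :
    Measurable fun x : Fin d → ℂ => pureState x j k := by
  unfold pureState
  have : (fun x : Fin d → ℂ => (if x = 0 then ((d : ℂ)⁻¹) • (1 : Matrix (Fin d) (Fin d) ℂ)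
      else (((∑ i, sqModuli x i)⁻¹ : ℝ) : ℂ) • Matrix.vecMulVec x (star x)) j k) =
      fun x => if x = 0 then ((d : ℂ)⁻¹) * (1 : Matrix (Fin d) (Fin d) ℂ) j k
        else (((∑ i, sqModuli x i)⁻¹ : ℝ) : ℂ) * (x j * star (x k)) := by
    funext x
    split_ifs <;> rfl
  rw [this]
  refine Measurable.ite (measurableSet_singleton 0) measurable_const ?_
  simp only [RCLike.star_def]
  unfold sqModuli
  fun_prop

/-- Below the threshold all projective measurements of Alice admit one local hidden state model. -/
theorem hasLHSModel_wernerState {d : ℕ} (hd : 2 ≤ d) {η : ℝ} (h1 : 1 - η ≤ 2 * d / (d + 1))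
    (h2 : η ≤ 1 - 1 / (d : ℝ)) (M : Set (Observable (Fin d))) :
    HasLHSModel.{u} M (wernerState d η) := by
  have hd0 : d ≠ 0 := by omega
  have hne : NeZero d := ⟨hd0⟩
  have hd' : (2 : ℝ) ≤ d := by exact_mod_cast hd
  -- `s = 1 - η` is dictated by matching Bob's conditioned state; the threshold on `η` is exactly `1
  -- / d ≤ s`.
  obtain ⟨q, hq, hs⟩ := exists_response (s := 1 - η) hd (by linarith) h1
  choose U l hA using fun A : Observable (Fin d) => exists_eq_ofEigen A
  have hprob := isProbabilityMeasure_weightedGaussian hd0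
  have hmq : ∀ (A : Observable (Fin d)) i, Measurable fun x : Fin d → ℂ =>
      q (sqModuli ((star (U A).1).mulVec x)) i := fun A i =>
    (hq.measurable_comp i).comp
      (Continuous.matrix_mulVec continuous_const continuous_id).measurable
  -- The lift only moves the hidden variable space into the universe `u`.
  let e : (Fin d → ℂ) ≃ᵐ ULift.{u} (Fin d → ℂ) := MeasurableEquiv.ulift.symm
  refine ⟨ULift.{u} (Fin d → ℂ), inferInstance, (weightedGaussian d).map e,
    fun x => pureState x.down,
    -- For a degenerate eigenvalue the probabilities of all basis vectors of its eigenspace are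
    -- added.
    fun A a x => ∑ i, if l A i = a then q (sqModuli ((star (U A).1).mulVec x.down)) i else 0,
    Measure.isProbabilityMeasure_map e.measurable.aemeasurable,
    fun x => isState_pureState hd0 _,
    fun i j => (measurable_pureState_apply i j).comp measurable_down,
    fun A _ a _ => ?_, fun A _ a _ x => ?_, fun A _ x => ?_, fun A _ a _ j k => ?_⟩
  · refine Finset.measurable_fun_sum _ fun i _ => ?_
    split_ifs
    · exact (hmq A i).comp measurable_down
    · exact measurable_const
  · refine Finset.sum_nonneg fun i _ => ?_
    split_ifs
    · exact hq.nonneg _ _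
    · exact le_rfl
  · rw [Finset.sum_comm]
    have ho : A.outcomes = Finset.univ.image (l A) := by
      conv_lhs => rw [hA A]
      exact outcomes_ofEigen _ _
    rw [ho]
    have : ∀ i, (∑ a ∈ Finset.univ.image (l A), if l A i = a then
        q (sqModuli ((star (U A).1).mulVec x.down)) i else 0) =
        q (sqModuli ((star (U A).1).mulVec x.down)) i := fun i => by
      rw [Finset.sum_ite_eq, if_pos (Finset.mem_image_of_mem _ (Finset.mem_univ i))]
    simp only [this, hq.sum_eq_one]
  · rw [integral_map_equiv, condState_wernerState]
    change _ = ∫ x, ((∑ i, if l A i = a then q (sqModuli ((star (U A).1).mulVec x)) i else 0 : ℝ) :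
      ℂ) * pureState x j k ∂(weightedGaussian d)
    rw [integral_weightedGaussian]
    have hP : A.projector a j k = ∑ i, if l A i = a then (U A).1 j i * star ((U A).1 k i) else 0 := by
      conv_lhs => rw [hA A]
      exact projector_ofEigen_apply _ _ _ _ _
    have hT : (A.projector a).trace = ∑ i, if l A i = a then (1 : ℂ) else 0 := by
      conv_lhs => rw [hA A]
      exact trace_projector_ofEigen _ _ _
    have hI : ∀ x : Fin d → ℂ,
        ((∑ i, if l A i = a then q (sqModuli ((star (U A).1).mulVec x)) i else 0 : ℝ) : ℂ) *
          pureState x j k * ((∑ i, sqModuli x i : ℝ) : ℂ) =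
        ∑ i, (if l A i = a then (1 : ℂ) else 0) *
          ((q (sqModuli ((star (U A).1).mulVec x)) i : ℂ) * (x j * star (x k))) := by
      intro x
      rw [mul_assoc, pureState_apply_mul, Complex.ofReal_sum, Finset.sum_mul]
      refine Finset.sum_congr rfl fun i _ => ?_
      split_ifs <;> simp
    simp only [hI]
    have hmom := fun i => hq.integral_mul_mul_conj_unitary hs (U A).2 i j k
    rw [integral_finsetSum _ fun i _ => (hmom i).1.const_mul _]
    simp only [integral_const_mul, (hmom _).2]
    rw [hP, hT, Finset.sum_div, Finset.sum_mul, Finset.mul_sum, Finset.mul_sum,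
      ← Finset.sum_sub_distrib]
    refine Finset.sum_congr rfl fun i _ => ?_
    -- With `s = 1 - η`, the coefficients of the identity and of the projector agree with the
    -- Gaussian moments; the final `/ d` comes from normalising the weight.
    have c1 : ((d : ℝ) - 1 + η) / ((d : ℝ) - 1) / (d : ℝ) ^ 2 =
        (1 - (1 - η) / d) / (d - 1) / d := by
      have : (d : ℝ) - 1 ≠ 0 := by linarith
      field_simp
      ring
    have c2 : η / ((d : ℝ) - 1) / (d : ℝ) =
        -(((1 - η) / d - (1 - (1 - η) / d) / (d - 1)) / d) := by
      have : (d : ℝ) - 1 ≠ 0 := by linarith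
      field_simp
      ring
    rw [c1, c2]
    split_ifs
    · push_cast; ring
    · simp

/-! ### Haar average of the least component. -/

theorem isCompact_unitaryGroup (d : ℕ) :
    IsCompact (Matrix.unitaryGroup (Fin d) ℂ : Set (Matrix (Fin d) (Fin d) ℂ)) := by
  have hK : IsCompact (univ.pi fun _ : Fin d => univ.pi fun _ : Fin d =>
      Metric.closedBall (0 : ℂ) 1) :=
    isCompact_univ_pi fun _ => isCompact_univ_pi fun _ => isCompact_closedBall _ _
  refine IsCompact.of_isClosed_subset hK isClosed_unitary fun U hU => ?_
  exact fun i _ j _ => mem_closedBall_zero_iff.2 (entry_norm_bound_of_unitary hU i j)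

/-- The normalized Haar measure on the unitary group, for its Borel structure. -/
theorem exists_haar_unitaryGroup (d : ℕ) :
    ∃ (_ : MeasurableSpace (Matrix.unitaryGroup (Fin d) ℂ))
      (h : Measure (Matrix.unitaryGroup (Fin d) ℂ)), IsProbabilityMeasure h ∧
      (∀ i j, Measurable fun U : Matrix.unitaryGroup (Fin d) ℂ => U.1 i j) ∧
      ∀ V, MeasurePreserving (fun U => V * U) h h := by
  have hc : CompactSpace (Matrix.unitaryGroup (Fin d) ℂ) :=
    isCompact_iff_compactSpace.1 (isCompact_unitaryGroup d)
  let _ : MeasurableSpace (Matrix.unitaryGroup (Fin d) ℂ) := borel _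
  have hb : BorelSpace (Matrix.unitaryGroup (Fin d) ℂ) := ⟨rfl⟩
  refine ⟨inferInstance, Measure.haarMeasure ⊤, ⟨?_⟩, fun i j => ?_, fun V => ?_⟩
  · have := Measure.haarMeasure_self (K₀ := (⊤ : TopologicalSpace.PositiveCompacts
      (Matrix.unitaryGroup (Fin d) ℂ)))
    simpa using this
  · exact (continuous_subtype_val.matrix_elem i j).measurable
  · exact measurePreserving_mul_left _ V

section average

variable {d : ℕ} [NeZero d]

theorem minEntry_const_mul {c : ℝ} (hc : 0 ≤ c) (X : Fin d → ℝ) :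
    minEntry (fun i => c * X i) = c * minEntry X := by
  obtain ⟨i, -, hi⟩ := Finset.exists_mem_eq_inf' Finset.univ_nonempty X
  refine le_antisymm ?_ (le_minEntry_iff.2 fun j => mul_le_mul_of_nonneg_left (minEntry_le X j) hc)
  have : minEntry X = X i := hi
  rw [this]
  exact minEntry_le (fun i => c * X i) i

theorem exists_unitary_mulVec_single {ψ : Fin d → ℂ} (hψ : ∑ i, sqModuli ψ i = 1) :
    ∃ V : Matrix.unitaryGroup (Fin d) ℂ, V.1.mulVec (Pi.single 0 1) = ψ := by
  have hn : ‖WithLp.toLp 2 ψ‖ = 1 := by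
    rw [EuclideanSpace.norm_eq, Real.sqrt_eq_one]
    exact hψ
  have hv : Orthonormal ℂ ((({0} : Set (Fin d))).domRestrict
      fun _ : Fin d => WithLp.toLp 2 ψ) := by
    refine ⟨fun i => hn, fun i j hij => ?_⟩
    exact absurd (Subtype.ext ((mem_singleton_iff.1 i.2).trans (mem_singleton_iff.1 j.2).symm)) hij
  obtain ⟨b, hb⟩ := hv.exists_orthonormalBasis_extension_of_card_eq (by simp)
  refine ⟨⟨(EuclideanSpace.basisFun (Fin d) ℂ).toBasis.toMatrix b,
    (EuclideanSpace.basisFun (Fin d) ℂ).toMatrix_orthonormalBasis_mem_unitary b⟩, ?_⟩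
  rw [Matrix.mulVec_single_one]
  funext i
  have := hb 0 rfl
  simp [Module.Basis.toMatrix_apply, this]

variable [MeasurableSpace (Matrix.unitaryGroup (Fin d) ℂ)]
  {h : Measure (Matrix.unitaryGroup (Fin d) ℂ)}

/-- The average over a measure on orthonormal bases of the least squared component of a vector. -/
def averageMin (h : Measure (Matrix.unitaryGroup (Fin d) ℂ)) (ψ : Fin d → ℂ) : ENNReal :=
  ∫⁻ U, ENNReal.ofReal (minEntry (sqModuli ((star U.1).mulVec ψ))) ∂h

theorem measurable_minEntry_mulVec
    (hm : ∀ i j, Measurable fun U : Matrix.unitaryGroup (Fin d) ℂ => U.1 i j) :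
    Measurable fun p : (Fin d → ℂ) × Matrix.unitaryGroup (Fin d) ℂ =>
      ENNReal.ofReal (minEntry (sqModuli ((star p.2.1).mulVec p.1))) := by
  refine ENNReal.measurable_ofReal.comp (measurable_minEntry.comp (measurable_sqModuli.comp ?_))
  refine measurable_pi_lambda _ fun i => ?_
  simp only [Matrix.mulVec, dotProduct]
  refine Finset.measurable_fun_sum _ fun j _ => ?_
  refine Measurable.mul ?_ ((measurable_pi_apply j).comp measurable_fst)
  simp only [Matrix.star_apply, RCLike.star_def]
  exact Complex.continuous_conj.measurable.comp ((hm j i).comp measurable_snd)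

/-- Left invariance of the measure, through the substitution of `star V * U` for `U`. -/
theorem averageMin_mulVec
    (hm : ∀ i j, Measurable fun U : Matrix.unitaryGroup (Fin d) ℂ => U.1 i j)
    (hinv : ∀ V, MeasurePreserving (fun U => V * U) h h)
    (V : Matrix.unitaryGroup (Fin d) ℂ) (ψ : Fin d → ℂ) :
    averageMin h (V.1.mulVec ψ) = averageMin h ψ := by
  have hf : Measurable fun U : Matrix.unitaryGroup (Fin d) ℂ =>
      ENNReal.ofReal (minEntry (sqModuli ((star U.1).mulVec ψ))) := by
    have h := (measurable_minEntry_mulVec hm).comp (measurable_prodMk_left (x := ψ))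
    exact h
  have key := (hinv (star V)).lintegral_comp hf
  unfold averageMin
  rw [← key]
  refine lintegral_congr fun U => ?_
  have : star (star V * U).1 = star U.1 * V.1 := by
    rw [Submonoid.coe_mul, Unitary.coe_star, star_mul, star_star]
  rw [Matrix.mulVec_mulVec, this]

theorem averageMin_smul {r : ℝ} (ψ : Fin d → ℂ) :
    averageMin h ((r : ℂ) • ψ) = ENNReal.ofReal (r ^ 2) * averageMin h ψ := by
  unfold averageMin
  rw [← lintegral_const_mul' _ _ ENNReal.ofReal_ne_top]
  refine lintegral_congr fun U => ?_
  rw [← ENNReal.ofReal_mul (sq_nonneg r), ← minEntry_const_mul (sq_nonneg r)]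
  congr 2
  funext i
  simp [Matrix.mulVec_smul, sqModuli, mul_pow]

/-- The average is unitarily invariant and homogeneous of degree two, and the unitary group is
transitive on unit vectors; so it is a multiple of the squared norm. -/
theorem averageMin_eq_mul
    (hm : ∀ i j, Measurable fun U : Matrix.unitaryGroup (Fin d) ℂ => U.1 i j)
    (hinv : ∀ V, MeasurePreserving (fun U => V * U) h h) (ψ : Fin d → ℂ) :
    averageMin h ψ = ENNReal.ofReal (∑ i, sqModuli ψ i) * averageMin h (Pi.single 0 1) := by
  by_cases hψ : ψ = 0
  · have := averageMin_smul (h := h) (r := 0) ψ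
    simp only [Complex.ofReal_zero, zero_smul] at this
    subst hψ
    rw [this]
    simp [sqModuli]
  · have hpos := sum_sqModuli_pos hψ
    set N := ∑ i, sqModuli ψ i with hN
    have hsq : √N ≠ 0 := (Real.sqrt_pos.2 hpos).ne'
    have h1 : ∑ i, sqModuli (((√N)⁻¹ : ℂ) • ψ) i = 1 := by
      have : ∀ i, sqModuli (((√N)⁻¹ : ℂ) • ψ) i = N⁻¹ * sqModuli ψ i := fun i => by
        simp [sqModuli, mul_pow, Real.sq_sqrt hpos.le]
      simp only [this, ← Finset.mul_sum, ← hN]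
      exact inv_mul_cancel₀ hpos.ne'
    obtain ⟨V, hV⟩ := exists_unitary_mulVec_single h1
    have h2 : ψ = (√N : ℂ) • V.1.mulVec (Pi.single 0 1) := by
      rw [hV, smul_smul, mul_inv_cancel₀ (Complex.ofReal_ne_zero.2 hsq), one_smul]
    conv_lhs => rw [h2]
    rw [averageMin_smul, averageMin_mulVec hm hinv, Real.sq_sqrt hpos.le]

/-- The mean over all orthonormal bases of the least squared component of a unit vector. -/
theorem averageMin_single [IsProbabilityMeasure h]
    (hm : ∀ i j, Measurable fun U : Matrix.unitaryGroup (Fin d) ℂ => U.1 i j)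
    (hinv : ∀ V, MeasurePreserving (fun U => V * U) h h) :
    averageMin h (Pi.single 0 1) = ENNReal.ofReal (1 / (d : ℝ) ^ 2) := by
  have hd : (0 : ℝ) < d := Nat.cast_pos.2 (NeZero.pos d)
  -- The constant is found by averaging also over a Gaussian `ψ` and computing in both orders: here
  -- through the mean squared norm `d`, in `h2` through the expected minimum `1 / d`, the same for
  -- each basis.
  have h1 : ∫⁻ ψ, averageMin h ψ ∂(gaussianVec d) =
      ENNReal.ofReal d * averageMin h (Pi.single 0 1) := by
    rw [lintegral_congr fun ψ => averageMin_eq_mul hm hinv ψ, lintegral_mul_const _ (by unfold sqModuli; fun_prop),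
      ← ofReal_integral_eq_lintegral_ofReal integrable_sum_sqModuli
        (ae_of_all _ fun x => Finset.sum_nonneg fun i _ => sqModuli_nonneg x i)]
    simp only [sqModuli]
    rw [integral_finsetSum _ fun i _ => integrable_norm_sq_apply i]
    simp only [integral_norm_sq_apply, Finset.sum_const, Finset.card_univ, Fintype.card_fin,
      nsmul_eq_mul, mul_one]
  have h2 : ∫⁻ ψ, averageMin h ψ ∂(gaussianVec d) = ENNReal.ofReal (1 / d) := by
    unfold averageMin
    rw [lintegral_lintegral_swap (measurable_minEntry_mulVec hm).aemeasurable]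
    have : ∀ U : Matrix.unitaryGroup (Fin d) ℂ,
        ∫⁻ ψ, ENNReal.ofReal (minEntry (sqModuli ((star U.1).mulVec ψ))) ∂(gaussianVec d) =
        ENNReal.ofReal (1 / d) := by
      intro U
      have hf : Measurable fun ψ : Fin d → ℂ => ENNReal.ofReal (minEntry (sqModuli ψ)) :=
        ENNReal.measurable_ofReal.comp (measurable_minEntry.comp measurable_sqModuli)
      refine ((measurePreserving_mulVec (star U).2).lintegral_comp hf).trans ?_
      rw [← ofReal_integral_eq_lintegral_ofReal integrable_minEntry
        (ae_of_all _ fun x => minEntry_nonneg (sqModuli_nonneg x)), integral_minEntry]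
    simp only [this, lintegral_const, measure_univ, mul_one]
  rw [h2] at h1
  have hd0 : ENNReal.ofReal d ≠ 0 := by simpa using NeZero.ne d
  rw [← (ENNReal.mul_right_inj hd0 ENNReal.ofReal_ne_top), ← h1, ← ENNReal.ofReal_mul hd.le]
  congr 1
  field_simp

end average

/-! ### The bound on `η` forced by a local hidden state model. -/

section steering

variable {d : ℕ}

theorem IsState.exists_eq_sum {ρ : Matrix (Fin d) (Fin d) ℂ} (hρ : IsState ρ) :
    ∃ (m : ℕ) (v : Fin m → Fin d → ℂ), (∀ j k, ρ j k = ∑ a, v a j * star (v a k)) ∧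
      ∑ a, ∑ j, sqModuli (v a) j = 1 := by
  obtain ⟨m, v, hv⟩ := Matrix.posSemidef_iff_eq_sum_vecMulVec.1 hρ.1
  have h : ∀ j k, ρ j k = ∑ a, v a j * star (v a k) := fun j k => by
    rw [hv, Matrix.sum_apply]
    rfl
  refine ⟨m, v, h, ?_⟩
  have ht := hρ.2
  simp only [Matrix.trace, Matrix.diag_apply, h] at ht
  rw [Finset.sum_comm] at ht
  simp only [RCLike.star_def, Complex.mul_conj'] at ht
  simp only [sqModuli]
  exact_mod_cast ht

/-- A crude bound, needed only for integrability. -/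
theorem IsState.norm_apply_le {ρ : Matrix (Fin d) (Fin d) ℂ} (hρ : IsState ρ) (j k : Fin d) :
    ‖ρ j k‖ ≤ 2 := by
  obtain ⟨m, v, hv, hs⟩ := hρ.exists_eq_sum
  have hle : ∀ i, ∑ a, ‖v a i‖ ^ 2 ≤ 1 := fun i => by
    rw [← hs]
    exact Finset.sum_le_sum fun a _ => Finset.single_le_sum (f := fun j => sqModuli (v a) j)
      (fun j _ => sqModuli_nonneg (v a) j) (Finset.mem_univ i)
  calc ‖ρ j k‖ ≤ ∑ a, ‖v a j * star (v a k)‖ := by rw [hv]; exact norm_sum_le _ _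
    _ ≤ ∑ a, (‖v a j‖ ^ 2 + ‖v a k‖ ^ 2) := Finset.sum_le_sum fun a _ => by
        rw [norm_mul, norm_star]
        nlinarith [sq_nonneg (‖v a j‖ - ‖v a k‖), sq_nonneg (‖v a j‖ + ‖v a k‖)]
    _ ≤ 2 := by rw [Finset.sum_add_distrib]; linarith [hle j, hle k]

/-- The diagonal of `ρ` in the orthonormal basis formed by the columns of `U`. -/
def diagIn (U ρ : Matrix (Fin d) (Fin d) ℂ) (i : Fin d) : ℝ :=
  (∑ j, ∑ k, star (U j i) * ρ j k * U k i).re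

theorem diagIn_eq_sum (U : Matrix (Fin d) (Fin d) ℂ) {ρ : Matrix (Fin d) (Fin d) ℂ} {m : ℕ}
    {v : Fin m → Fin d → ℂ} (hv : ∀ j k, ρ j k = ∑ a, v a j * star (v a k)) (i : Fin d) :
    ∑ j, ∑ k, star (U j i) * ρ j k * U k i =
      ((∑ a, sqModuli ((star U).mulVec (v a)) i : ℝ) : ℂ) := by
  have h : ∀ a, ((sqModuli ((star U).mulVec (v a)) i : ℝ) : ℂ) =
      ∑ j, ∑ k, star (U j i) * (v a j * star (v a k)) * U k i := by
    intro a
    simp only [sqModuli, Complex.ofReal_pow]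
    rw [← Complex.mul_conj', ← RCLike.star_def]
    simp only [Matrix.mulVec, dotProduct, Matrix.star_apply, star_sum, star_mul', star_star]
    rw [Finset.sum_mul_sum]
    exact Finset.sum_congr rfl fun j _ => Finset.sum_congr rfl fun k _ => by ring
  rw [Complex.ofReal_sum]
  simp only [h, hv]
  rw [Finset.sum_comm]
  simp only [Finset.mul_sum, Finset.sum_mul]
  rw [Finset.sum_comm]
  refine Eq.symm ?_
  rw [Finset.sum_comm]
  refine Finset.sum_congr rfl fun j _ => ?_
  rw [Finset.sum_comm]

theorem IsState.ofReal_diagIn {ρ : Matrix (Fin d) (Fin d) ℂ} (hρ : IsState ρ)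
    (U : Matrix (Fin d) (Fin d) ℂ) (i : Fin d) :
    ((diagIn U ρ i : ℝ) : ℂ) = ∑ j, ∑ k, star (U j i) * ρ j k * U k i := by
  obtain ⟨m, v, hv, -⟩ := hρ.exists_eq_sum
  rw [diagIn, diagIn_eq_sum U hv, Complex.ofReal_re]

theorem IsState.diagIn_nonneg {ρ : Matrix (Fin d) (Fin d) ℂ} (hρ : IsState ρ)
    (U : Matrix (Fin d) (Fin d) ℂ) : 0 ≤ diagIn U ρ := fun i => by
  obtain ⟨m, v, hv, -⟩ := hρ.exists_eq_sum
  rw [diagIn, diagIn_eq_sum U hv, Complex.ofReal_re]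
  exact Finset.sum_nonneg fun a _ => sqModuli_nonneg _ i

/-- The mean over all orthonormal bases of the least diagonal entry of a state is smallest for
pure states. -/
theorem IsState.le_lintegral_minEntry_diagIn [NeZero d]
    [MeasurableSpace (Matrix.unitaryGroup (Fin d) ℂ)]
    {h : Measure (Matrix.unitaryGroup (Fin d) ℂ)} [IsProbabilityMeasure h]
    (hm : ∀ i j, Measurable fun U : Matrix.unitaryGroup (Fin d) ℂ => U.1 i j)
    (hinv : ∀ V, MeasurePreserving (fun U => V * U) h h)
    {ρ : Matrix (Fin d) (Fin d) ℂ} (hρ : IsState ρ) :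
    ENNReal.ofReal (1 / (d : ℝ) ^ 2) ≤ ∫⁻ U, ENNReal.ofReal (minEntry (diagIn U.1 ρ)) ∂h := by
  obtain ⟨m, v, hv, hs⟩ := hρ.exists_eq_sum
  -- Superadditivity of the minimum, applied to a decomposition of `ρ` into unnormalised pure
  -- states.
  have hle : ∀ U : Matrix.unitaryGroup (Fin d) ℂ,
      ∑ a, ENNReal.ofReal (minEntry (sqModuli ((star U.1).mulVec (v a)))) ≤
        ENNReal.ofReal (minEntry (diagIn U.1 ρ)) := by
    intro U
    rw [← ENNReal.ofReal_sum_of_nonneg fun a _ => minEntry_nonneg (sqModuli_nonneg _)]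
    refine ENNReal.ofReal_le_ofReal (le_minEntry_iff.2 fun i => ?_)
    rw [diagIn, diagIn_eq_sum U.1 hv, Complex.ofReal_re]
    exact Finset.sum_le_sum fun a _ => minEntry_le _ i
  refine le_trans ?_ (lintegral_mono hle)
  have hmeas : ∀ a, Measurable fun U : Matrix.unitaryGroup (Fin d) ℂ =>
      ENNReal.ofReal (minEntry (sqModuli ((star U.1).mulVec (v a)))) := fun a => by
    have h := (measurable_minEntry_mulVec hm).comp (measurable_prodMk_left (x := v a))
    exact h
  rw [lintegral_finsetSum _ fun a _ => hmeas a]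
  change _ ≤ ∑ a, averageMin h (v a)
  rw [Finset.sum_congr rfl fun a _ => averageMin_eq_mul hm hinv (v a), ← Finset.sum_mul,
    ← ENNReal.ofReal_sum_of_nonneg fun a _ => Finset.sum_nonneg fun i _ => sqModuli_nonneg _ i,
    hs, averageMin_single hm hinv]
  simp

/-- The diagonal entry of Bob's conditioned state at the eigenvector Alice has found. It depends
neither on the basis nor on the result, so the `d` results together contribute `(1 - η) / d`. -/
theorem sum_sum_star_mul_condState (hd : 2 ≤ d) (η : ℝ) (U : Matrix.unitaryGroup (Fin d) ℂ)
    {l : Fin d → ℝ} (hl : Function.Injective l) (i : Fin d) :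
    ∑ j, ∑ k, star (U.1 j i) * condState (wernerState d η) (ofEigen U l) (l i) j k * U.1 k i =
      (((1 - η) / (d : ℝ) ^ 2 : ℝ) : ℂ) := by
  have hd' : (2 : ℝ) ≤ d := by exact_mod_cast hd
  have htr : ((ofEigen U l).projector (l i)).trace = 1 := by
    rw [trace_projector_ofEigen]
    simp [hl.eq_iff]
  have hcol : ∑ j, star (U.1 j i) * U.1 j i = 1 := by
    have := congrFun (congrFun (Matrix.mem_unitaryGroup_iff'.1 U.2) i) i
    rw [Matrix.mul_apply, Matrix.one_apply_eq] at this
    exact this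
  have hP : ∀ j k, (ofEigen U l).projector (l i) j k = U.1 j i * star (U.1 k i) := fun j k => by
    rw [projector_ofEigen_apply]
    simp [hl.eq_iff]
  simp only [condState_wernerState, htr, hP, mul_sub, sub_mul, Finset.sum_sub_distrib, one_mul]
  have e1 : ∀ c : ℂ, ∑ j, ∑ k, star (U.1 j i) * (c * (1 : Matrix (Fin d) (Fin d) ℂ) j k) * U.1 k i =
      c := fun c => by
    have : ∀ j, ∑ k, star (U.1 j i) * (c * (1 : Matrix (Fin d) (Fin d) ℂ) j k) * U.1 k i =
        c * (star (U.1 j i) * U.1 j i) := fun j => by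
      rw [Finset.sum_eq_single j (fun k _ hk => by simp [Matrix.one_apply_ne hk.symm]) (by simp),
        Matrix.one_apply_eq]
      ring
    simp only [this, ← Finset.mul_sum, hcol, mul_one]
  have e2 : ∀ c : ℂ, ∑ j, ∑ k, star (U.1 j i) * (c * (U.1 j i * star (U.1 k i))) * U.1 k i =
      c := fun c => by
    have : ∀ j k, star (U.1 j i) * (c * (U.1 j i * star (U.1 k i))) * U.1 k i =
        c * ((star (U.1 j i) * U.1 j i) * (star (U.1 k i) * U.1 k i)) := fun j k => by ring
    simp only [this, ← Finset.mul_sum, hcol, mul_one]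
  rw [e1, e2, ← Complex.ofReal_sub]
  congr 1
  have : (d : ℝ) - 1 ≠ 0 := by linarith
  field_simp
  ring

/-- A local hidden state model for one nondegenerate observable bounds the mean of the least
diagonal entry, in the eigenbasis of the observable, of the states of the ensemble. -/
theorem lintegral_minEntry_diagIn_le [NeZero d] (hd : 2 ≤ d) {η : ℝ} {Ξ : Type*}
    [MeasurableSpace Ξ] {μ : Measure Ξ} [IsProbabilityMeasure μ]
    {ρ : Ξ → Matrix (Fin d) (Fin d) ℂ} (hρ : ∀ ξ, IsState (ρ ξ))
    (hρm : ∀ i j, Measurable fun ξ => ρ ξ i j) (U : Matrix.unitaryGroup (Fin d) ℂ)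
    {l : Fin d → ℝ} (hl : Function.Injective l) {p : ℝ → Ξ → ℝ}
    (hpm : ∀ a ∈ (ofEigen U l).outcomes, Measurable (p a))
    (hp0 : ∀ a ∈ (ofEigen U l).outcomes, ∀ ξ, 0 ≤ p a ξ)
    (hp1 : ∀ ξ, ∑ a ∈ (ofEigen U l).outcomes, p a ξ = 1)
    (hp : ∀ a ∈ (ofEigen U l).outcomes, ∀ i j,
      condState (wernerState d η) (ofEigen U l) a i j = ∫ ξ, (p a ξ : ℂ) * ρ ξ i j ∂μ) :
    ∫⁻ ξ, ENNReal.ofReal (minEntry (diagIn U.1 (ρ ξ))) ∂μ ≤ ENNReal.ofReal ((1 - η) / d) := by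
  rw [outcomes_ofEigen] at hpm hp0 hp1 hp
  simp only [Finset.sum_image fun i _ j _ h => hl h] at hp1
  have hmem : ∀ i, l i ∈ Finset.univ.image l := fun i =>
    Finset.mem_image_of_mem _ (Finset.mem_univ i)
  have hple : ∀ i ξ, p (l i) ξ ≤ 1 := fun i ξ => by
    rw [← hp1 ξ]
    exact Finset.single_le_sum (f := fun i => p (l i) ξ) (fun j _ => hp0 _ (hmem j) ξ)
      (Finset.mem_univ i)
  have hint : ∀ i j k, Integrable (fun ξ => (p (l i) ξ : ℂ) * ρ ξ j k) μ := fun i j k => by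
    refine (integrable_const (2 : ℝ)).mono' ((Complex.measurable_ofReal.comp
      (hpm _ (hmem i))).mul (hρm j k)).aestronglyMeasurable (ae_of_all _ fun ξ => ?_)
    rw [norm_mul, Complex.norm_real, norm_eq_abs, abs_of_nonneg (hp0 _ (hmem i) ξ)]
    exact (mul_le_of_le_one_left (norm_nonneg _) (hple i ξ)).trans ((hρ ξ).norm_apply_le j k)
  have hexp : ∀ i ξ, ((p (l i) ξ * diagIn U.1 (ρ ξ) i : ℝ) : ℂ) =
      ∑ j, ∑ k, star (U.1 j i) * U.1 k i * ((p (l i) ξ : ℂ) * ρ ξ j k) := fun i ξ => by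
    rw [Complex.ofReal_mul, (hρ ξ).ofReal_diagIn, Finset.mul_sum]
    refine Finset.sum_congr rfl fun j _ => ?_
    rw [Finset.mul_sum]
    exact Finset.sum_congr rfl fun k _ => by ring
  have hintC : ∀ i, Integrable (fun ξ => ((p (l i) ξ * diagIn U.1 (ρ ξ) i : ℝ) : ℂ)) μ :=
    fun i => by
      simp only [hexp]
      exact integrable_finsetSum _ fun j _ => integrable_finsetSum _ fun k _ =>
        (hint i j k).const_mul _
  have hintR : ∀ i, Integrable (fun ξ => p (l i) ξ * diagIn U.1 (ρ ξ) i) μ := fun i => by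
    simpa using (hintC i).re
  have hval : ∀ i, ∫ ξ, p (l i) ξ * diagIn U.1 (ρ ξ) i ∂μ = (1 - η) / (d : ℝ) ^ 2 := fun i => by
    have h1 : ((∫ ξ, p (l i) ξ * diagIn U.1 (ρ ξ) i ∂μ : ℝ) : ℂ) =
        (((1 - η) / (d : ℝ) ^ 2 : ℝ) : ℂ) := by
      rw [← integral_complex_ofReal, ← sum_sum_star_mul_condState hd η U hl i]
      simp only [hexp]
      rw [integral_finsetSum _ fun j _ => integrable_finsetSum _ fun k _ =>
        (hint i j k).const_mul _]
      refine Finset.sum_congr rfl fun j _ => ?_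
      rw [integral_finsetSum _ fun k _ => (hint i j k).const_mul _]
      refine Finset.sum_congr rfl fun k _ => ?_
      rw [integral_const_mul, ← hp _ (hmem i)]
      ring
    exact_mod_cast h1
  -- For each `ξ` the numbers `p (l i) ξ` are convex weights, so the least entry is at most the
  -- weighted mean.
  calc ∫⁻ ξ, ENNReal.ofReal (minEntry (diagIn U.1 (ρ ξ))) ∂μ
      ≤ ∫⁻ ξ, ENNReal.ofReal (∑ i, p (l i) ξ * diagIn U.1 (ρ ξ) i) ∂μ := by
        refine lintegral_mono fun ξ => ENNReal.ofReal_le_ofReal ?_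
        calc minEntry (diagIn U.1 (ρ ξ))
            = ∑ i, p (l i) ξ * minEntry (diagIn U.1 (ρ ξ)) := by
              rw [← Finset.sum_mul, hp1, one_mul]
          _ ≤ _ := Finset.sum_le_sum fun i _ =>
              mul_le_mul_of_nonneg_left (minEntry_le _ i) (hp0 _ (hmem i) ξ)
    _ = ENNReal.ofReal ((1 - η) / d) := by
        rw [← ofReal_integral_eq_lintegral_ofReal (integrable_finsetSum _ fun i _ => hintR i)
          (ae_of_all _ fun ξ => Finset.sum_nonneg fun i _ =>
            mul_nonneg (hp0 _ (hmem i) ξ) ((hρ ξ).diagIn_nonneg U.1 i)),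
          integral_finsetSum _ fun i _ => hintR i]
        simp only [hval, Finset.sum_const, Finset.card_univ, Fintype.card_fin, nsmul_eq_mul]
        have : (d : ℝ) ≠ 0 := Nat.cast_ne_zero.2 (by omega)
        congr 1
        field_simp

/-- A local hidden state model for all projective measurements exists only below the threshold. -/
theorem le_of_hasLHSModel (hd : 2 ≤ d) {η : ℝ}
    (hM : HasLHSModel.{u} (Set.univ : Set (Observable (Fin d))) (wernerState d η)) :
    η ≤ 1 - 1 / (d : ℝ) := by
  have hne : NeZero d := ⟨by omega⟩
  have hd0 : (0 : ℝ) < d := Nat.cast_pos.2 (by omega)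
  obtain ⟨Ξ, _, μ, ρ, p, hμ, hρ, hρm, hpm, hp0, hp1, hp⟩ := hM
  obtain ⟨_, h, hh, hm, hinv⟩ := exists_haar_unitaryGroup d
  -- Any distinct eigenvalues would do: one nondegenerate observable is used for each orthonormal
  -- basis.
  let l : Fin d → ℝ := fun i => (i : ℕ)
  have hl : Function.Injective l := fun i j hij => Fin.ext (Nat.cast_injective hij)
  have hupper : ∀ U : Matrix.unitaryGroup (Fin d) ℂ,
      ∫⁻ ξ, ENNReal.ofReal (minEntry (diagIn U.1 (ρ ξ))) ∂μ ≤ ENNReal.ofReal ((1 - η) / d) :=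
    fun U => lintegral_minEntry_diagIn_le hd hρ hρm U hl (hpm _ (mem_univ _))
      (hp0 _ (mem_univ _)) (hp1 _ (mem_univ _)) (hp _ (mem_univ _))
  have hjm : Measurable fun x : Ξ × Matrix.unitaryGroup (Fin d) ℂ =>
      ENNReal.ofReal (minEntry (diagIn x.2.1 (ρ x.1))) := by
    refine ENNReal.measurable_ofReal.comp (measurable_minEntry.comp
      (measurable_pi_lambda _ fun i => Complex.measurable_re.comp
        (Finset.measurable_fun_sum _ fun j _ => Finset.measurable_fun_sum _ fun k _ => ?_)))
    refine Measurable.mul (Measurable.mul ?_ ((hρm j k).comp measurable_fst))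
      ((hm k i).comp measurable_snd)
    simp only [RCLike.star_def]
    exact Complex.continuous_conj.measurable.comp ((hm j i).comp measurable_snd)
  have hle : ENNReal.ofReal (1 / (d : ℝ) ^ 2) ≤ ENNReal.ofReal ((1 - η) / d) := by
    calc ENNReal.ofReal (1 / (d : ℝ) ^ 2)
        = ∫⁻ _, ENNReal.ofReal (1 / (d : ℝ) ^ 2) ∂μ := by simp
      _ ≤ ∫⁻ ξ, ∫⁻ U, ENNReal.ofReal (minEntry (diagIn U.1 (ρ ξ))) ∂h ∂μ :=
          lintegral_mono fun ξ => (hρ ξ).le_lintegral_minEntry_diagIn hm hinv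
      _ = ∫⁻ U, ∫⁻ ξ, ENNReal.ofReal (minEntry (diagIn U.1 (ρ ξ))) ∂μ ∂h :=
          lintegral_lintegral_swap hjm.aemeasurable
      _ ≤ ∫⁻ _, ENNReal.ofReal ((1 - η) / d) ∂h := lintegral_mono hupper
      _ = ENNReal.ofReal ((1 - η) / d) := by simp
  -- `ENNReal.ofReal` truncates negative numbers, but positivity of `1 / d ^ 2` still lets the
  -- inequality descend to the reals.
  have hle' : 1 / (d : ℝ) ^ 2 ≤ (1 - η) / d := by
    by_contra hcon
    push Not at hcon
    exact absurd hle (not_le.2 ((ENNReal.ofReal_lt_ofReal_iff (by positivity)).2 hcon))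
  have h2 := mul_le_mul_of_nonneg_left hle' hd0.le
  have h3 : (d : ℝ) * (1 / (d : ℝ) ^ 2) = 1 / d := by field_simp
  rw [h3, mul_div_cancel₀ _ hd0.ne'] at h2
  linarith

end steering

end QSteering

end

theorem mainTheorem3 (d : ℕ) (hd : 2 ≤ d) (η : ℝ)
    (hW : QSteering.IsState (QSteering.wernerState d η)) :
    (QSteering.ExhibitsSteering.{u}
        (Set.univ : Set (QSteering.Observable (Fin d))) (QSteering.wernerState d η) ↔
      1 - 1 / (d : ℝ) < η) ∧
    (QSteering.Steerable.{u} (QSteering.wernerState d η) ↔ 1 - 1 / (d : ℝ) < η) := by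
  -- The model covers every set of observables at once, so both equivalences have the same
  -- threshold. Positivity enters only here, to bound `η` from below.
  have hmodel : ∀ M : Set (QSteering.Observable (Fin d)),
      QSteering.ExhibitsSteering.{u} M (QSteering.wernerState d η) → 1 - 1 / (d : ℝ) < η :=
    fun M hM => not_le.1 fun h => hM
      (QSteering.hasLHSModel_wernerState hd (QSteering.le_of_isState_wernerState hd hW) h M)
  have huniv : 1 - 1 / (d : ℝ) < η → QSteering.ExhibitsSteering.{u}
      (Set.univ : Set (QSteering.Observable (Fin d))) (QSteering.wernerState d η) :=
    fun h hM => not_le.2 h (QSteering.le_of_hasLHSModel hd hM)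
  exact ⟨⟨hmodel _, huniv⟩, fun ⟨M, hM⟩ => hmodel M hM, fun h => ⟨_, huniv h⟩⟩
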